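/- Let $K$ be a field of characteristic zero. All matroids are finite. **Notation.** For a matroid $M$ of rank $k$ with rank function $r$ on an $n$-element set $E$, let $\mathcal G(M)=\sum_{\pi}[\underline r(\pi)]$, summed over all orderings $\pi=(e_1,\dots,e_n)$ of $E$, where $\underline r(\pi)=r_1r_2\cdots r_n$ with $r_i=r(\{e_1,\dots,e_i\})-r(\{e_1,\dots,e_{i-1}\})$, in the $K$-vector space with basis the formal symbols $[s]$ of finite sequences $s$ (it contains, for all $n,k$, the space $\mathcal G(n,k)$ spanned by the $[s]$ with $s$ a sequence of $k$ ones and $n-k$ zeros). An $(n,k)$-composition is an integer sequence $(a_0,\dots,a_k)$ with sum $n$, $a_0\ge 0$ and $a_i>0$ for $i\ge1$. A flag of $M$ is a chain of flats $X_0\subset X_1\subset\cdots\subset X_k$ with $r(X_i)=i$; its composition is $(|X_0|,|X_1-X_0|,\dots,|X_k-X_{k-1}|)$, and $\nu(M;(a_i))$ is the number of flags of $M$ with composition $(a_i)$. The vector $\gamma((a_i))$ is the contribution of one flag with composition $(a_i)$ to $\mathcal G$: given disjoint blocks $B_0,\dots,B_k$ with $|B_i|=a_i$, it is the sum, over all orderings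 of $B_0\cup\cdots\cup B_k$ in which the first elements of $B_1,\dots,B_k$ appear in this order, of $[s]$, where $s$ has a one at the first element of each of $B_1,\dots,B_k$ and zeros elsewhere. **The free $m$-cone.** Let $M$ be loopless and $m\ge1$. Let $T_e$ ($e\in E$) be sets of size $m$, disjoint from $E$ and from each other, and $a$ a further element. For $S\subseteq E$ put $q(S)=S\cup\{a\}\cup\bigcup_{e\in S}T_e$. The free $m$-cone $Q_m(M)$ is the matroid on $q(E)$ defined by the following cyclic flats and ranks: the cyclic flats $Z$ of $M$, with rank $r(Z)$, and the sets $q(F)$, for $F$ a nonempty flat of $M$, with rank $r(F)+1$. That is, $I\subseteq q(E)$ is independent if and only if $I$ meets each of these sets in at most as many elements as the given rank. For a composition $(a_0,\dots,a_k)$, an integer $0\le h\le k$ and $C\subseteq[h]=\{1,\dots,h\}$, let $\hat f((a_i),h,C)=(b_0,\dots,b_{k+1})$, where $b_0=0$; for $1\le i\le h$, $b_i=1$ if $i\in C$, and $b_i=a_j$ if $i$ is the $j$-th smallest element of $[h]-C$; $b_{h+1}=1+\sum_{j=1}^h\bigl((m+1)a_j-b_j\bigr)$; and $b_i=(m+1)a_{i-1}$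 for $i>h+1$. Let $$\Gamma_m((a_i))=\sum_{h=0}^{k}\ \sum_{C\subseteq[h]}\Bigl(\prod_{j=1}^{|C|}m\,a_{h-|C|+j}\Bigr)\,\gamma\bigl(\hat f((a_i),h,C)\bigr).$$ **Theorem.** Fix $m\ge1$. 1. For every loopless matroid $M$, the cyclic flats of $Q_m(M)$ and their ranks are exactly those prescribed above. 2. For every loopless matroid $M$ of size $n$ and rank $k$, $$\mathcal G(Q_m(M))=\sum_{(a_i)}\nu(M;(a_i))\,\Gamma_m((a_i)),$$ where the sum is over all $(n,k)$-compositions. 3. $\mathcal G(Q_m(M))$ is determined by $\mathcal G(M)$: there is a $K$-linear map $\Phi$, depending only on $m$ and $K$, with $\Phi(\gamma((a_i)))=\Gamma_m((a_i))$ for every composition $(a_i)$, and $\mathcal G(Q_m(M))=\Phi(\mathcal G(M))$ for every loopless matroid $M$. 4. In particular, if $M$ and $N$ are loopless and $\mathcal G(M)=\mathcal G(N)$, then $\mathcal G(Q_m(M))=\mathcal G(Q_m(N))$. -/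

import Mathlib

universe u v w

noncomputable section

/-! ### Cyclic flats -/

/-- A cyclic flat of `M`: a flat `Z` such that the restriction of `M` to `Z` has no coloops. -/
def Matroid.IsCyclicFlat {α : Type u} (M : Matroid α) (Z : Set α) : Prop :=
  M.IsFlat Z ∧ ∀ e, ¬ (M.restrict Z).IsColoop e

/-- The cyclic flats of `M` together with their ranks. -/
def Matroid.cyclicFlatData {α : Type u} (M : Matroid α) : Set (Set α × ℕ∞) :=
  {P | M.IsCyclicFlat P.1 ∧ P.2 = M.eRk P.1}

/-- The rank function with natural number values (used for finite matroids only). -/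
def Matroid.natRk {α : Type u} (M : Matroid α) (X : Set α) : ℕ := (M.eRk X).toNat

/-! ### The free `m`-cone -/

/-- The elements from which the ground set of the free `m`-cone is formed: `base e` is the element
`e` of the original matroid, `copy e j` (for `j : Fin m`) are the `m` elements of `T_e`, and `tip`
is the tip `a`. -/
inductive ConeElt (α : Type u) (m : ℕ) : Type u
  | base (e : α) : ConeElt α m
  | copy (e : α) (j : Fin m) : ConeElt α m
  | tip : ConeElt α m

/-- The cone `q(S) = S ∪ {a} ∪ ⋃_{e ∈ S} T_e`. -/
def coneSet {α : Type u} (m : ℕ) (S : Set α) : Set (ConeElt α m) :=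
  {x | (∃ e ∈ S, x = .base e) ∨ (∃ e ∈ S, ∃ j, x = .copy e j) ∨ x = .tip}

/-- The pairs `(Z, r_Q(Z))` with `Z` in `𝒵(Q)`: the cyclic flats `Z` of `M`, with rank `r(Z)`, and
the cones `q(F)` of the nonempty flats `F` of `M`, with rank `r(F) + 1`. -/
def coneData {α : Type u} (m : ℕ) (M : Matroid α) : Set (Set (ConeElt α m) × ℕ∞) :=
  {P | (∃ Z, M.IsCyclicFlat Z ∧ P = (ConeElt.base '' Z, M.eRk Z)) ∨
    (∃ F, M.IsFlat F ∧ F.Nonempty ∧ P = (coneSet m F, M.eRk F + 1))}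

/-- The independent sets of the matroid on `E(Q) = q(E)` defined by the cyclic flats and ranks in
`coneData`: those `I` with `|I ∩ Z| ≤ r_Q(Z)` for all `Z` in `𝒵(Q)`. -/
def ConeIndep {α : Type u} (m : ℕ) (M : Matroid α) (I : Set (ConeElt α m)) : Prop :=
  I ⊆ coneSet m M.E ∧ ∀ P ∈ coneData m M, (I ∩ P.1).encard ≤ P.2

/-- Augmentation for the independent sets of an integer polymatroid. -/
theorem polymatroid_aug {β : Type u} (f : Set β → ℕ) (f0 : f ∅ = 0)
    (fmono : ∀ A B, A ⊆ B → f A ≤ f B) (fsub : ∀ A B, f (A ∪ B) + f (A ∩ B) ≤ f A + f B)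
    (I J : Set β) (hIfin : I.Finite) (hJfin : J.Finite)
    (hI : ∀ A ⊆ I, A.ncard ≤ f A) (hJ : ∀ A ⊆ J, A.ncard ≤ f A) (hlt : I.ncard < J.ncard) :
    ∃ e ∈ J, e ∉ I ∧ ∀ A ⊆ insert e I, A.ncard ≤ f A := by
  by_contra! hcon
  have key : ∀ e ∈ J, e ∉ I → ∃ A ⊆ I, f (insert e A) ≤ A.ncard := by
    intro e heJ heI
    obtain ⟨A, hA, hlt⟩ := hcon e heJ heI
    have heA : e ∈ A := by
      by_contra h
      exact absurd (hI A ((Set.subset_insert_iff_of_notMem h).1 hA)) (by omega)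
    have hAfin : A.Finite := (hIfin.insert e).subset hA
    refine ⟨A \ {e}, by simpa [Set.sdiff_subset_iff] using hA, ?_⟩
    have h1 := Set.ncard_sdiff_singleton_add_one heA hAfin
    have h2 : insert e (A \ {e}) = A := by simp [Set.insert_eq_of_mem heA]
    rw [h2]; omega
  have step : ∀ S : Set β, S.Finite → S ⊆ J \ I → ∃ A ⊆ I, f (A ∪ S) ≤ A.ncard := by
    intro S hS
    induction S, hS using Set.Finite.induction_on with
    | empty => intro _; exact ⟨∅, by simp, by simp [f0]⟩
    | @insert e S _ _ ih =>
      intro hsub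
      obtain ⟨A, hAI, hA⟩ := ih ((Set.subset_insert _ _).trans hsub)
      have he := hsub (Set.mem_insert e S)
      obtain ⟨B, hBI, hB⟩ := key e he.1 he.2
      refine ⟨A ∪ B, Set.union_subset hAI hBI, ?_⟩
      have h1 := fsub (A ∪ S) (insert e B)
      have h2 : A ∪ S ∪ insert e B = A ∪ B ∪ insert e S := by
        ext x; simp only [Set.mem_union, Set.mem_insert_iff]; tauto
      have h3 := hI (A ∩ B) (Set.inter_subset_left.trans hAI)
      have h4 := fmono (A ∩ B) ((A ∪ S) ∩ insert e B) (Set.inter_subset_inter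
        Set.subset_union_left (Set.subset_insert _ _))
      have h5 := Set.ncard_union_add_ncard_inter A B (hIfin.subset hAI) (hIfin.subset hBI)
      rw [h2] at h1
      omega
  obtain ⟨A, hAI, hA⟩ := step (J \ I) hJfin.sdiff subset_rfl
  have hAfin := hIfin.subset hAI
  have h1 := hJ ((A ∩ J) ∪ (J \ I)) (Set.union_subset Set.inter_subset_right Set.sdiff_subset)
  have h2 := fmono ((A ∩ J) ∪ (J \ I)) (A ∪ (J \ I))
    (Set.union_subset_union_left _ Set.inter_subset_left)
  have h3 : ((A ∩ J) ∪ (J \ I)).ncard = (A ∩ J).ncard + (J \ I).ncard :=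
    Set.ncard_union_eq (Set.disjoint_left.2 fun x hx hx' => hx'.2 (hAI hx.1))
      (hAfin.inter_of_left _) hJfin.sdiff
  have h4 := Set.ncard_inter_add_ncard_sdiff_eq_ncard A J hAfin
  have h5 := Set.ncard_inter_add_ncard_sdiff_eq_ncard I J hIfin
  have h6 := Set.ncard_inter_add_ncard_sdiff_eq_ncard J I hJfin
  have h7 : (A \ J).ncard ≤ (I \ J).ncard :=
    Set.ncard_le_ncard (Set.sdiff_subset_sdiff_left hAI) hIfin.sdiff
  rw [Set.inter_comm J I] at h6
  omega

theorem Matroid.IsCircuit.isCyclicFlat_closure {α : Type u} {M : Matroid α} {C : Set α}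
    (hC : M.IsCircuit C) : M.IsCyclicFlat (M.closure C) := by
  refine ⟨M.isFlat_closure C, fun e he => ?_⟩
  have hCs : C ⊆ M.closure C := M.subset_closure C hC.subset_ground
  have hcE : M.closure C ⊆ M.E := M.closure_subset_ground C
  have heC : e ∈ M.closure C := he.mem_ground
  by_cases h : e ∈ C
  · exact ((Matroid.restrict_isCircuit_iff hcE).2 ⟨hC, hCs⟩).not_isColoop_of_mem h he
  · have h1 : e ∈ (M.restrict (M.closure C)).closure C := by
      rw [Matroid.restrict_closure_eq _ hCs hcE]; exact ⟨heC, heC⟩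
    exact h (he.mem_of_mem_closure h1)

/-- The projection `p`. -/
def coneProj {α : Type u} {m : ℕ} (S : Set (ConeElt α m)) : Set α :=
  {e | .base e ∈ S ∨ ∃ j, .copy e j ∈ S}

open Classical in
/-- The submodular function whose polymatroid gives the free cone. -/
def coneFun {α : Type u} (m : ℕ) (M : Matroid α) (A : Set (ConeElt α m)) : ℕ :=
  M.natRk (coneProj A) + if A ⊆ Set.range ConeElt.base then 0 else 1

theorem Matroid.natRk_cast {α : Type u} (M : Matroid α) [M.Finite] (X : Set α) :
    (M.natRk X : ℕ∞) = M.eRk X :=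
  ENat.natCast_toNat (Matroid.eRk_ne_top_iff.2 (M.isRkFinite_set X))

theorem Matroid.natRk_mono {α : Type u} (M : Matroid α) [M.Finite] {X Y : Set α} (h : X ⊆ Y) :
    M.natRk X ≤ M.natRk Y := by
  have := M.eRk_mono h
  rw [← M.natRk_cast, ← M.natRk_cast] at this
  exact_mod_cast this

theorem Matroid.natRk_submod {α : Type u} (M : Matroid α) [M.Finite] (X Y : Set α) :
    M.natRk (X ∪ Y) + M.natRk (X ∩ Y) ≤ M.natRk X + M.natRk Y := by
  have := M.eRk_inter_add_eRk_union_le X Y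
  simp only [← M.natRk_cast] at this
  have h : M.natRk (X ∩ Y) + M.natRk (X ∪ Y) ≤ M.natRk X + M.natRk Y := by exact_mod_cast this
  omega

theorem coneProj_mono {α : Type u} {m : ℕ} {A B : Set (ConeElt α m)} (h : A ⊆ B) :
    coneProj A ⊆ coneProj B := by
  rintro e (he | ⟨j, hj⟩)
  exacts [Or.inl (h he), Or.inr ⟨j, h hj⟩]

theorem coneProj_union {α : Type u} {m : ℕ} (A B : Set (ConeElt α m)) :
    coneProj (A ∪ B) = coneProj A ∪ coneProj B := by
  ext e
  simp only [coneProj, Set.mem_union, Set.mem_ofPred_eq, exists_or]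
  tauto

theorem coneFun_empty {α : Type u} (m : ℕ) (M : Matroid α) : coneFun m M ∅ = 0 := by
  simp [coneFun, coneProj, Matroid.natRk]

theorem coneFun_mono {α : Type u} (m : ℕ) (M : Matroid α) [M.Finite] (A B : Set (ConeElt α m))
    (h : A ⊆ B) : coneFun m M A ≤ coneFun m M B := by
  have h1 := M.natRk_mono (coneProj_mono h)
  unfold coneFun
  by_cases hB : B ⊆ Set.range ConeElt.base
  · rw [if_pos hB, if_pos (h.trans hB)]; omega
  · rw [if_neg hB]; split_ifs <;> omega

theorem coneFun_submod {α : Type u} (m : ℕ) (M : Matroid α) [M.Finite]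
    (A B : Set (ConeElt α m)) :
    coneFun m M (A ∪ B) + coneFun m M (A ∩ B) ≤ coneFun m M A + coneFun m M B := by
  have h1 := M.natRk_submod (coneProj A) (coneProj B)
  have h2 : M.natRk (coneProj (A ∩ B)) ≤ M.natRk (coneProj A ∩ coneProj B) :=
    M.natRk_mono (Set.subset_inter (coneProj_mono Set.inter_subset_left)
      (coneProj_mono Set.inter_subset_right))
  unfold coneFun
  rw [coneProj_union]
  by_cases hA : A ⊆ Set.range ConeElt.base
  · have hAB : A ∩ B ⊆ Set.range ConeElt.base := Set.inter_subset_left.trans hA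
    rw [if_pos hA, if_pos hAB]
    by_cases hB : B ⊆ Set.range ConeElt.base
    · rw [if_pos hB, if_pos (Set.union_subset hA hB)]; omega
    · rw [if_neg hB]; split_ifs <;> omega
  · rw [if_neg hA]
    by_cases hB : B ⊆ Set.range ConeElt.base
    · have hAB : A ∩ B ⊆ Set.range ConeElt.base := Set.inter_subset_right.trans hB
      rw [if_pos hB, if_pos hAB]; split_ifs <;> omega
    · rw [if_neg hB]; split_ifs <;> omega

theorem coneSet_finite {α : Type u} (m : ℕ) {S : Set α} (hS : S.Finite) :
    (coneSet m S).Finite := by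
  have h : coneSet m S = (ConeElt.base '' S) ∪
      ((fun p : α × Fin m => ConeElt.copy p.1 p.2) '' (S ×ˢ Set.univ)) ∪ {ConeElt.tip} := by
    ext x
    simp only [coneSet, Set.mem_ofPred_eq, Set.mem_union, Set.mem_image, Set.mem_prod,
      Set.mem_univ, and_true, Prod.exists, Set.mem_singleton_iff, or_assoc]
    refine or_congr ?_ (or_congr ?_ Iff.rfl)
    · exact ⟨fun ⟨e, h, he⟩ => ⟨e, h, he.symm⟩, fun ⟨e, h, he⟩ => ⟨e, h, he.symm⟩⟩
    · exact ⟨fun ⟨e, h, j, he⟩ => ⟨e, j, h, he.symm⟩, fun ⟨e, j, h, he⟩ => ⟨e, h, j, he.symm⟩⟩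
  rw [h]
  exact ((hS.image _).union ((hS.prod Set.finite_univ).image _)).union (Set.finite_singleton _)

theorem ConeElt.base_injective {α : Type u} {m : ℕ} :
    Function.Injective (ConeElt.base : α → ConeElt α m) := fun _ _ h => by cases h; rfl

theorem coneProj_subset {α : Type u} {m : ℕ} {S : Set α} {A : Set (ConeElt α m)}
    (h : A ⊆ coneSet m S) : coneProj A ⊆ S := by
  rintro e (he | ⟨j, hj⟩)
  · rcases h he with ⟨e', h', h2⟩ | ⟨e', h', j, h2⟩ | h2 <;> cases h2
    exact h'
  · rcases h hj with ⟨e', h', h2⟩ | ⟨e', h', j, h2⟩ | h2 <;> cases h2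
    exact h'

theorem subset_coneSet_coneProj {α : Type u} {m : ℕ} (A : Set (ConeElt α m)) :
    A ⊆ coneSet m (coneProj A) := by
  rintro (e | ⟨e, j⟩ | _) hx
  · exact Or.inl ⟨e, Or.inl hx, rfl⟩
  · exact Or.inr (Or.inl ⟨e, Or.inr ⟨j, hx⟩, j, rfl⟩)
  · exact Or.inr (Or.inr rfl)

theorem coneSet_mono {α : Type u} (m : ℕ) {S T : Set α} (h : S ⊆ T) :
    coneSet m S ⊆ coneSet m T := by
  rintro x (⟨e, he, hx⟩ | ⟨e, he, hx⟩ | hx)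
  exacts [Or.inl ⟨e, h he, hx⟩, Or.inr (Or.inl ⟨e, h he, hx⟩), Or.inr (Or.inr hx)]

theorem coneIndep_iff {α : Type u} (m : ℕ) (M : Matroid α) [M.Finite] (I : Set (ConeElt α m)) :
    ConeIndep m M I ↔ I ⊆ coneSet m M.E ∧ ∀ A ⊆ I, A.ncard ≤ coneFun m M A := by
  refine and_congr_right fun hIE => ?_
  have hIfin : I.Finite := (coneSet_finite m M.ground_finite).subset hIE
  constructor
  · intro h A hAI
    have hAfin := hIfin.subset hAI
    have hpE : coneProj A ⊆ M.E := coneProj_subset (hAI.trans hIE)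
    unfold coneFun
    by_cases hA : A ⊆ Set.range ConeElt.base
    · rw [if_pos hA, add_zero]
      have hAp : A = ConeElt.base '' coneProj A := by
        ext x
        constructor
        · intro hx
          obtain ⟨e, rfl⟩ := hA hx
          exact ⟨e, Or.inl hx, rfl⟩
        · rintro ⟨e, he | ⟨j, hj⟩, rfl⟩
          · exact he
          · obtain ⟨e', he'⟩ := hA hj
            cases he'
      have hind : M.Indep (coneProj A) := by
        by_contra hdep
        obtain ⟨C, hCA, hC⟩ := ((Matroid.not_indep_iff hpE).1 hdep).exists_isCircuit_subset
        have h1 := h _ (Or.inl ⟨M.closure C, hC.isCyclicFlat_closure, rfl⟩)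
        have h2 : (ConeElt.base '' C : Set (ConeElt α m)) ⊆ I ∩ ConeElt.base '' (M.closure C) := by
          refine Set.subset_inter ?_ (Set.image_mono (M.subset_closure C hC.subset_ground))
          exact ((Set.image_mono hCA).trans hAp.symm.subset).trans hAI
        have h3 := (Set.encard_le_encard h2).trans h1
        rw [ConeElt.base_injective.encard_image] at h3
        simp only [Matroid.eRk_closure_eq] at h3
        rw [← hC.eRk_add_one_eq, ← M.natRk_cast] at h3
        have : M.natRk C + 1 ≤ M.natRk C := by exact_mod_cast h3
        omega
      have h4 : (M.natRk (coneProj A) : ℕ∞) = (A.ncard : ℕ∞) := by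
        rw [M.natRk_cast, hind.eRk_eq_encard, hAfin.cast_ncard_eq]
        conv_rhs => rw [hAp]
        rw [ConeElt.base_injective.encard_image]
      have h5 : M.natRk (coneProj A) = A.ncard := by exact_mod_cast h4
      exact h5.ge
    · rw [if_neg hA]
      rcases (coneProj A).eq_empty_or_nonempty with he | hne
      · have h1 : A ⊆ {ConeElt.tip} := by
          intro x hx
          have := subset_coneSet_coneProj A hx
          simpa [coneSet, he] using this
        have h2 := Set.ncard_le_ncard h1
        rw [Set.ncard_singleton] at h2
        omega
      · have hsub := M.subset_closure _ hpE
        have h1 := h _ (Or.inr ⟨M.closure (coneProj A), M.isFlat_closure _, hne.mono hsub, rfl⟩)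
        have h2 : A ⊆ I ∩ coneSet m (M.closure (coneProj A)) :=
          Set.subset_inter hAI ((subset_coneSet_coneProj A).trans (coneSet_mono m hsub))
        have h3 := (Set.encard_le_encard h2).trans h1
        simp only [Matroid.eRk_closure_eq] at h3
        rw [← hAfin.cast_ncard_eq, ← M.natRk_cast] at h3
        exact_mod_cast h3
  · intro h P hP
    have h1 := h (I ∩ P.1) Set.inter_subset_left
    have hfin : (I ∩ P.1).Finite := hIfin.inter_of_left _
    rw [← hfin.cast_ncard_eq]
    rcases hP with ⟨Z, hZ, rfl⟩ | ⟨F, hF, _, rfl⟩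
    · have h2 : I ∩ ConeElt.base '' Z ⊆ Set.range ConeElt.base :=
        Set.inter_subset_right.trans (Set.image_subset_range _ _)
      have h3 : coneProj (I ∩ ConeElt.base '' Z) ⊆ Z := by
        rintro e (⟨_, e', he', h⟩ | ⟨j, _, e', he', h⟩) <;> cases h
        exact he'
      have h4 := M.natRk_mono h3
      unfold coneFun at h1
      rw [if_pos h2] at h1
      simp only at h1 ⊢
      rw [← M.natRk_cast]
      exact_mod_cast h1.trans h4
    · have h3 : coneProj (I ∩ coneSet m F) ⊆ F := coneProj_subset Set.inter_subset_right
      have h4 := M.natRk_mono h3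
      have h5 : (I ∩ coneSet m F).ncard ≤ M.natRk F + 1 := by
        unfold coneFun at h1
        simp only at h1
        split_ifs at h1 <;> omega
      simp only
      rw [← M.natRk_cast]
      exact_mod_cast h5

/-- The free `m`-cone `Q_m(M)`: the matroid on `q(E)` defined by `𝒵(Q)` and `r_Q`. -/
def freeCone {α : Type u} (m : ℕ) (M : Matroid α) [M.Finite] : Matroid (ConeElt α m) :=
  (IndepMatroid.ofFinite (coneSet_finite m M.ground_finite) (ConeIndep m M)
    (by
      refine ⟨Set.empty_subset _, fun P _ => ?_⟩
      simp)
    (fun I J hJ hIJ => ⟨hIJ.trans hJ.1, fun P hP =>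
      (Set.encard_le_encard (Set.inter_subset_inter_left _ hIJ)).trans (hJ.2 P hP)⟩)
    (by
      intro I J hI hJ hlt
      rw [coneIndep_iff] at hI hJ
      have hfin := coneSet_finite m M.ground_finite
      obtain ⟨e, heJ, heI, h⟩ := polymatroid_aug (coneFun m M) (coneFun_empty m M)
        (coneFun_mono m M) (coneFun_submod m M) I J (hfin.subset hI.1) (hfin.subset hJ.1)
        hI.2 hJ.2 hlt
      exact ⟨e, heJ, heI, (coneIndep_iff m M _).2
        ⟨Set.insert_subset (hJ.1 heJ) hI.1, h⟩⟩)
    (fun I hI => hI.1)).matroid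

instance freeCone_finite {α : Type u} (m : ℕ) (M : Matroid α) [M.Finite] :
    (freeCone m M).Finite :=
  ⟨coneSet_finite m M.ground_finite⟩

/-! ### The `𝒢`-invariant -/

/-- The vector space over `K` with one basis vector `[s]` for each finite sequence `s`; it contains
`𝒢(n, k)`, the span of the `[s]` with `s` a sequence of `k` ones and `n - k` zeros, for all `n` and
`k`. -/
abbrev GSpace (K : Type w) [Field K] : Type w := List ℕ →₀ K

/-- The rank sequence `r_1 r_2 … r_n` of an ordering `π(1), π(2), …, π(n)` of the ground set. -/
def rankSeq {α : Type u} (M : Matroid α) {n : ℕ} (π : Fin n ≃ M.E) : List ℕ :=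
  List.ofFn fun i : Fin n =>
    M.natRk {x | ∃ j ≤ i, x = (π j : α)} - M.natRk {x | ∃ j < i, x = (π j : α)}

open Classical in
/-- The `𝒢`-invariant of a matroid: the sum of `[r(π)]` over all orderings `π` of the ground
set. -/
def gInvariant (K : Type w) [Field K] {α : Type u} (M : Matroid α) [M.Finite] : GSpace K :=
  letI : Fintype M.E := M.ground_finite.fintype
  ∑ π : Fin M.E.ncard ≃ M.E, Finsupp.single (rankSeq M π) 1

/-! ### Catenary data and the `γ`-basis -/

/-- The set of `(n, k)`-compositions: sequences `(a_0, …, a_k)` with sum `n` and `a_i > 0` for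
`i ≥ 1`. -/
def compositions (n k : ℕ) : Finset (Fin (k + 1) → ℕ) :=
  (Finset.piAntidiag Finset.univ n).filter fun a => ∀ i : Fin k, 0 < a i.succ

/-- A flag `(X_0, X_1, …, X_k)` of `M`, where `k` is the rank of `M`. -/
def IsFlag {α : Type u} (M : Matroid α) {k : ℕ} (X : Fin (k + 1) → Set α) : Prop :=
  (∀ i, M.IsFlat (X i) ∧ M.eRk (X i) = (i : ℕ)) ∧ ∀ i : Fin k, X i.castSucc ⊂ X i.succ

/-- The composition `(|X_0|, |X_1 - X_0|, …, |X_k - X_{k-1}|)`. -/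
def flagComposition {α : Type u} {k : ℕ} (X : Fin (k + 1) → Set α) : Fin (k + 1) → ℕ :=
  Fin.cases (X 0).ncard fun i : Fin k => (X i.succ \ X i.castSucc).ncard

/-- `ν(M; (a_i))`: the number of flags of `M` with composition `(a_i)`. -/
def catenary {α : Type u} (M : Matroid α) {k : ℕ} (a : Fin (k + 1) → ℕ) : ℕ :=
  {X : Fin (k + 1) → Set α | IsFlag M X ∧ flagComposition X = a}.ncard

/-- An ordering `π` of the disjoint union of blocks of sizes `a_0, a_1, …, a_k` is adapted if the
first elements of the blocks `1, 2, …, k` occur in this order (block `0` is unconstrained): when an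
element of block `i` occurs, each of the blocks `1, …, i - 1` has already been met. -/
def Adapted {k : ℕ} {a : Fin (k + 1) → ℕ} (π : Fin (∑ i, a i) ≃ (i : Fin (k + 1)) × Fin (a i)) :
    Prop :=
  ∀ j, ∀ t : Fin (k + 1), 0 < t → t < (π j).1 → ∃ j' < j, (π j').1 = t

/-- The sequence with a one at the first element of each of the blocks `1, …, k`, and zeros
elsewhere. -/
def blockSeq {k : ℕ} {a : Fin (k + 1) → ℕ} (π : Fin (∑ i, a i) ≃ (i : Fin (k + 1)) × Fin (a i)) :
    List ℕ :=
  List.ofFn fun j => if (π j).1 ≠ 0 ∧ ∀ j' < j, (π j').1 ≠ (π j).1 then 1 else 0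

open Classical in
/-- The `γ`-basis vector `γ((a_i))`: the contribution to the `𝒢`-invariant of a single flag with
composition `(a_i)`, that is, the sum of `[s(π)]` over the adapted orderings `π`, where `s(π)` is
`blockSeq π`. -/
def gammaVec (K : Type w) [Field K] {k : ℕ} (a : Fin (k + 1) → ℕ) : GSpace K :=
  ∑ π : Fin (∑ i, a i) ≃ (i : Fin (k + 1)) × Fin (a i) with Adapted π,
    Finsupp.single (blockSeq π) 1

/-! ### The formula for the free cone -/

/-- The entry `a_j` (zero for `j > k`). -/
def entry {k : ℕ} (a : Fin (k + 1) → ℕ) (j : ℕ) : ℕ := if h : j < k + 1 then a ⟨j, h⟩ else 0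

/-- The entries `b_i` for `1 ≤ i ≤ h`: `b_i = 1` if `i ∈ C`, and `b_i = a_j` if `i` is the `j`-th
element of `[h] - C`. -/
def lowEntry {k : ℕ} (a : Fin (k + 1) → ℕ) (C : Finset ℕ) (i : ℕ) : ℕ :=
  if i ∈ C then 1 else entry a (Finset.Icc 1 i \ C).card

/-- The composition `(b_0, …, b_{k+1})` attached to `(a_i)`, `h` and `C ⊆ [h]`. -/
def coneComposition (m : ℕ) {k : ℕ} (a : Fin (k + 1) → ℕ) (h : ℕ) (C : Finset ℕ) :
    Fin (k + 2) → ℕ := fun i =>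
  if (i : ℕ) = 0 then 0
  else if (i : ℕ) ≤ h then lowEntry a C i
  else if (i : ℕ) = h + 1 then
    1 + (m + 1) * ∑ j ∈ Finset.Icc 1 h, entry a j - ∑ j ∈ Finset.Icc 1 h, lowEntry a C j
  else (m + 1) * entry a (i - 1)

/-- The inner double sum over `0 ≤ h ≤ k` and `C ⊆ [h]` in the formula for `𝒢(Q_m(M))`. -/
def coneGamma (K : Type w) [Field K] (m : ℕ) {k : ℕ} (a : Fin (k + 1) → ℕ) : GSpace K :=
  ∑ h ∈ Finset.range (k + 1), ∑ C ∈ (Finset.Icc 1 h).powerset,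
    (∏ j ∈ Finset.Icc 1 C.card, m * entry a (h - C.card + j)) •
      gammaVec K (coneComposition m a h C)

end

/-!
The `𝒢`-invariant of a matroid `M` is a sum over the flags of `M`. The closures of the prefixes of
an ordering of the ground set form a flag, and once the ground set is cut into the blocks of a flag
`X`, the orderings that generate `X` are the adapted orderings of the blocks, with the same rank
sequences (`generates_iff`, `gInvariant_eq_sum_flags`). So it suffices to describe the flags of the
free cone `Q`.

Let `p` send each element of `Q` other than the tip to the element of `M` below it. For a subset `A` of `Q` with base part `X`
and with `S` the set of its remaining elements, the rank of `A` is
`min (r(X) + |S|) (r(p(A)) + 1)` (`natRk_freeCone`). Hence the flats with the tip are the cones of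
flats of `M`, and the flats without the tip consist of a flat `X` of `M` and a set `S` of copies of
elements that are independent over `X`; the latter is cyclic only if `S` is empty. This gives the
cyclic flats (`cyclicFlatData_freeCone`).

In a flag of `Q`, let `h` be the index of the last member without the tip. Up to `h`, each step
either enlarges the base part or adds one copy; let `C` be the set of positions of the latter kind.
Continuing the chain of base parts by the closures with the elements below the copies, and then by
the projections of the members with the tip, gives a flag of `M`. Conversely, a flag of `M` with
composition `(a_i)`, together with `h`, `C` and a choice of copies, one of an element of each of the
blocks `h - |C| + 1, …, h`, comes from exactly one flag of `Q` (`coneFlag_injective`,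
`exists_coneFlag_eq`). The number of choices is the product of the `m * a_j` over these blocks, and
the flag of `Q` has the composition `coneComposition m a h C` (`flagComposition_coneFlag`). Summing
gives the formula for the invariant of `Q`.

Finally, the vectors `γ(a)` are linearly independent, because the sequence in `γ(a)` whose ones
stand as far to the right as possible determines `a` (`linearIndependent_gammaVec`). This yields the
linear map `Φ`, and with it the fact that the invariant of `M` determines that of `Q`.
-/

noncomputable section

/-! ### Natural-number ranks -/

namespace Matroid

theorem natRk_closure {α : Type u} (M : Matroid α) (X : Set α) :
    M.natRk (M.closure X) = M.natRk X := by
  simp [natRk]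

theorem natRk_empty {α : Type u} (M : Matroid α) : M.natRk ∅ = 0 := by simp [natRk]

theorem natRk_insert_of_mem_closure {α : Type u} (M : Matroid α) {e : α} {X : Set α}
    (h : e ∈ M.closure X) :
    M.natRk (insert e X) = M.natRk X := by
  rw [← M.natRk_closure, closure_insert_eq_of_mem_closure h, M.natRk_closure]

theorem isFlat_of_forall_natRk_lt {α : Type u} (M : Matroid α) {F : Set α} (hF : F ⊆ M.E)
    (h : ∀ e ∈ M.E, e ∉ F → M.natRk F < M.natRk (insert e F)) : M.IsFlat F := by
  rw [isFlat_iff_closure_eq]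
  refine subset_antisymm (fun e he => ?_) (M.subset_closure F)
  by_contra hcon
  have h1 := h e (M.closure_subset_ground F he) hcon
  rw [M.natRk_insert_of_mem_closure he] at h1
  omega

variable {α : Type u} (M : Matroid α) [M.Finite]

theorem eRk_eq_iff_natRk {X : Set α} {i : ℕ} : M.eRk X = i ↔ M.natRk X = i := by
  rw [← M.natRk_cast]; norm_cast

theorem natRk_insert_le (e : α) (X : Set α) : M.natRk (insert e X) ≤ M.natRk X + 1 := by
  have := M.eRk_insert_le_add_one e X
  rw [← M.natRk_cast, ← M.natRk_cast] at this
  exact_mod_cast this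

theorem natRk_insert_of_notMem_closure {e : α} {X : Set α} (he : e ∈ M.E)
    (h : e ∉ M.closure X) : M.natRk (insert e X) = M.natRk X + 1 := by
  have := M.eRk_insert_eq_add_one ⟨he, h⟩
  rw [← M.natRk_cast, ← M.natRk_cast] at this
  exact_mod_cast this

theorem closure_eq_closure_of_natRk_le {X Y : Set α} (hXY : X ⊆ Y)
    (h : M.natRk Y ≤ M.natRk X) : M.closure X = M.closure Y := by
  refine (M.isRkFinite_set X).closure_eq_closure_of_subset_of_eRk_ge_eRk hXY ?_
  rw [← M.natRk_cast, ← M.natRk_cast]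
  exact_mod_cast h

theorem mem_closure_of_natRk_insert_le {e : α} {X : Set α} (he : e ∈ M.E)
    (h : M.natRk (insert e X) ≤ M.natRk X) : e ∈ M.closure X := by
  by_contra hcl
  have := M.natRk_insert_of_notMem_closure he hcl
  omega

theorem IsFlat.eq_of_subset_of_natRk_le {M : Matroid α} [M.Finite] {X Y : Set α}
    (hX : M.IsFlat X) (hY : M.IsFlat Y) (hXY : X ⊆ Y) (h : M.natRk Y ≤ M.natRk X) : X = Y := by
  rw [← hX.closure, ← hY.closure]
  exact M.closure_eq_closure_of_natRk_le hXY h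

theorem natRk_le_ncard {X : Set α} (hX : X.Finite) : M.natRk X ≤ X.ncard := by
  have := M.eRk_le_encard X
  rw [← M.natRk_cast, ← hX.cast_ncard_eq] at this
  exact_mod_cast this

theorem natRk_union_le (X Y : Set α) : M.natRk (X ∪ Y) ≤ M.natRk X + M.natRk Y := by
  have := M.natRk_submod X Y
  omega

theorem IsFlat.natRk_insert {M : Matroid α} [M.Finite] {F : Set α} (hF : M.IsFlat F) {e : α}
    (he : e ∈ M.E) (heF : e ∉ F) : M.natRk (insert e F) = M.natRk F + 1 :=
  M.natRk_insert_of_notMem_closure he (by rwa [hF.closure])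

end Matroid

/-! ### Flags -/

/-- The flag `X`, indexed by all natural numbers: it stays at its last member from `k` on. This
avoids casts between the types `Fin (k + 1)` and `Fin k`. -/
def flagAt {α : Type u} {k : ℕ} (X : Fin (k + 1) → Set α) (i : ℕ) : Set α :=
  X ⟨min i k, by omega⟩

section Flags

variable {α : Type u} {M : Matroid α} {k : ℕ} {X : Fin (k + 1) → Set α}

theorem flagAt_coe (X : Fin (k + 1) → Set α) (i : Fin (k + 1)) : flagAt X i = X i := by
  unfold flagAt
  congr 1
  ext
  simp
  omega

theorem flagAt_of_le (X : Fin (k + 1) → Set α) {i : ℕ} (h : i ≤ k) :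
    flagAt X i = X ⟨i, by omega⟩ := flagAt_coe X ⟨i, by omega⟩

theorem isFlag_of_natRk [M.Finite] (h : ∀ i, M.IsFlat (X i) ∧ M.natRk (X i) = i)
    (hsub : ∀ i : Fin k, X i.castSucc ⊆ X i.succ) : IsFlag M X := by
  refine ⟨fun i => ⟨(h i).1, M.eRk_eq_iff_natRk.2 (h i).2⟩, fun i => ?_⟩
  refine (hsub i).ssubset_of_ne fun heq => ?_
  have h1 := (h i.castSucc).2
  rw [heq, (h i.succ).2] at h1
  simp at h1

namespace IsFlag

variable (hX : IsFlag M X)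
include hX

theorem isFlat_flagAt (i : ℕ) : M.IsFlat (flagAt X i) := (hX.1 _).1

theorem natRk_flagAt [M.Finite] {i : ℕ} (hi : i ≤ k) : M.natRk (flagAt X i) = i := by
  rw [flagAt_of_le X hi]
  exact M.eRk_eq_iff_natRk.1 (hX.1 _).2

theorem flagAt_mono : Monotone (flagAt X) := by
  refine monotone_nat_of_le_succ fun i => ?_
  by_cases h : i < k
  · rw [flagAt_of_le X h.le, flagAt_of_le X (show i + 1 ≤ k by omega)]
    exact (hX.2 ⟨i, h⟩).subset
  · apply le_of_eq
    unfold flagAt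
    congr 2
    omega

theorem flagAt_subset_ground (i : ℕ) : flagAt X i ⊆ M.E := (hX.isFlat_flagAt i).subset_ground

theorem flagAt_top (hk : M.eRank = k) [M.Finite] : flagAt X k = M.E := by
  refine (hX.isFlat_flagAt k).eq_of_subset_of_natRk_le M.ground_isFlat
    (hX.flagAt_subset_ground k) ?_
  rw [hX.natRk_flagAt le_rfl]
  have : M.natRk M.E = k := M.eRk_eq_iff_natRk.1 (by rw [M.eRk_ground, hk])
  omega

theorem flagAt_zero [M.Finite] : flagAt X 0 = M.loops := by
  refine (M.isFlat_closure ∅).eq_of_subset_of_natRk_le (hX.isFlat_flagAt 0)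
    (hX.isFlat_flagAt 0).loops_subset ?_ |>.symm
  rw [hX.natRk_flagAt (Nat.zero_le k)]
  exact Nat.zero_le _

end IsFlag

theorem flagComposition_zero (X : Fin (k + 1) → Set α) :
    flagComposition X 0 = (flagAt X 0).ncard := by
  rw [flagAt_of_le X (Nat.zero_le k)]; rfl

theorem flagComposition_succ (X : Fin (k + 1) → Set α) {i : ℕ} (hi : i < k) :
    flagComposition X ⟨i + 1, by omega⟩ = (flagAt X (i + 1) \ flagAt X i).ncard := by
  rw [flagAt_of_le X (show i + 1 ≤ k from hi), flagAt_of_le X hi.le]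
  rfl

theorem isFlag_finite (M : Matroid α) [M.Finite] (k : ℕ) :
    {X : Fin (k + 1) → Set α | IsFlag M X}.Finite := by
  refine (Set.Finite.pi' (t := fun _ => M.E.powerset)
    fun _ => M.ground_finite.finite_subsets).subset fun X hX i => ?_
  exact (hX.1 i).1.subset_ground

/-- The flags of `M` of length `k`, as a finite set. -/
def flags (M : Matroid α) [M.Finite] (k : ℕ) : Finset (Fin (k + 1) → Set α) :=
  (isFlag_finite M k).toFinset

@[simp] theorem mem_flags [M.Finite] : X ∈ flags M k ↔ IsFlag M X := by simp [flags]

theorem catenary_eq_card [M.Finite] [DecidableEq (Fin (k + 1) → ℕ)] (a : Fin (k + 1) → ℕ) :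
    catenary M a = ((flags M k).filter fun X => flagComposition X = a).card := by
  rw [catenary, ← Set.ncard_coe_finset]
  congr 1
  ext X
  simp

/-- The entries of the composition of a flag add up to the size of its last member. -/
theorem IsFlag.sum_flagComposition [M.Finite] (hX : IsFlag M X) :
    ∑ i, flagComposition X i = (flagAt X k).ncard := by
  have key : ∀ j (hj : j ≤ k), ∑ i : Fin (j + 1), flagComposition X ⟨i, by omega⟩
      = (flagAt X j).ncard := by
    intro j
    induction j with
    | zero => intro _; simp [← flagComposition_zero]
    | succ j ih =>
      intro hj
      rw [Fin.sum_univ_castSucc]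
      simp only [Fin.val_castSucc, Fin.val_last]
      rw [ih (by omega), flagComposition_succ X hj, add_comm]
      exact Set.ncard_sdiff_add_ncard_of_subset (hX.flagAt_mono (Nat.le_succ j))
        (M.ground_finite.subset (hX.flagAt_subset_ground _))
  exact key k le_rfl

theorem IsFlag.flagComposition_succ_pos [M.Finite] (hX : IsFlag M X) (i : Fin k) :
    0 < flagComposition X i.succ := by
  have h1 : (flagComposition X i.succ) = (X i.succ \ X i.castSucc).ncard := rfl
  rw [h1, Set.ncard_pos ((M.ground_finite.subset (hX.1 _).1.subset_ground).sdiff)]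
  exact Set.sdiff_nonempty.2 (hX.2 i).2

theorem IsFlag.flagComposition_mem [M.Finite] (hX : IsFlag M X) (hk : M.eRank = k) :
    flagComposition X ∈ compositions M.E.ncard k := by
  simp only [compositions, Finset.mem_filter, Finset.mem_piAntidiag, Finset.mem_univ,
    implies_true, and_true]
  exact ⟨by rw [hX.sum_flagComposition, hX.flagAt_top hk], hX.flagComposition_succ_pos⟩

end Flags

/-! ### The `𝒢`-invariant as a sum over flags -/

theorem Finset.sum_eq_sum_of_existsUnique {ι κ A : Type*} [AddCommMonoid A] (s : Finset ι)
    (t : Finset κ) (R : ι → κ → Prop) [∀ i j, Decidable (R i j)] (f : ι → A)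
    (h : ∀ i ∈ s, ∃! j, j ∈ t ∧ R i j) :
    ∑ i ∈ s, f i = ∑ j ∈ t, ∑ i ∈ s with R i j, f i := by
  simp_rw [Finset.sum_filter]
  rw [Finset.sum_comm]
  refine Finset.sum_congr rfl fun i hi => ?_
  obtain ⟨j, ⟨hj, hR⟩, huniq⟩ := h i hi
  rw [Finset.sum_eq_single_of_mem j hj, if_pos hR]
  intro j' hj' hne
  exact if_neg fun hR' => hne (huniq j' ⟨hj', hR'⟩)

section Orderings

variable {α : Type u} {M : Matroid α} {n k : ℕ}

/-- The set of the first `j` elements of an ordering of the ground set. -/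
def prefixSet (π : Fin n ≃ M.E) (j : ℕ) : Set α := {x | ∃ i : Fin n, (i : ℕ) < j ∧ x = π i}

variable (π : Fin n ≃ M.E)

theorem prefixSet_zero : prefixSet π 0 = ∅ := by simp [prefixSet]

theorem prefixSet_subset_ground (j : ℕ) : prefixSet π j ⊆ M.E := by
  rintro x ⟨i, _, rfl⟩
  exact (π i).2

theorem prefixSet_mono : Monotone (prefixSet π) := by
  rintro j j' h x ⟨i, hi, rfl⟩
  exact ⟨i, hi.trans_le h, rfl⟩

theorem prefixSet_succ (j : Fin n) :
    prefixSet π (j + 1) = insert (π j : α) (prefixSet π j) := by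
  ext x
  constructor
  · rintro ⟨i, hi, rfl⟩
    rcases Nat.lt_succ_iff_lt_or_eq.1 hi with h | h
    · exact Or.inr ⟨i, h, rfl⟩
    · exact Or.inl (by rw [Fin.ext h])
  · rintro (rfl | ⟨i, hi, rfl⟩)
    · exact ⟨j, Nat.lt_succ_self _, rfl⟩
    · exact ⟨i, by omega, rfl⟩

theorem prefixSet_of_le {j : ℕ} (h : n ≤ j) : prefixSet π j = M.E := by
  refine subset_antisymm (prefixSet_subset_ground π j) fun x hx => ?_
  exact ⟨π.symm ⟨x, hx⟩, (π.symm ⟨x, hx⟩).2.trans_le h, by simp⟩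

theorem mem_prefixSet_iff {i : Fin n} {j : ℕ} : (π i : α) ∈ prefixSet π j ↔ (i : ℕ) < j := by
  constructor
  · rintro ⟨i', hi', h⟩
    rwa [π.injective (Subtype.ext h)]
  · exact fun h => ⟨i, h, rfl⟩

theorem rankSeq_eq : rankSeq M π = List.ofFn fun j : Fin n =>
    M.natRk (prefixSet π (j + 1)) - M.natRk (prefixSet π j) := by
  unfold rankSeq prefixSet
  simp only [Nat.lt_succ_iff, Fin.val_fin_le, Fin.val_fin_lt]

variable [M.Finite]

/-- The ranks of the prefixes grow in steps of at most one. -/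
theorem exists_rank_step {i j : ℕ} (h : i + 1 ≤ M.natRk (prefixSet π j)) :
    ∃ j' : Fin n, (j' : ℕ) < j ∧ M.natRk (prefixSet π j') = i ∧
      M.natRk (prefixSet π (j' + 1)) = i + 1 := by
  induction j with
  | zero => rw [prefixSet_zero, M.natRk_empty] at h; omega
  | succ j ih =>
    by_cases hj : i + 1 ≤ M.natRk (prefixSet π j)
    · obtain ⟨j', h1, h2⟩ := ih hj
      exact ⟨j', by omega, h2⟩
    · have hjn : j < n := by
        by_contra hcon
        rw [prefixSet_of_le π (by omega)] at h hj
        exact hj h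
      have h1 := prefixSet_succ π ⟨j, hjn⟩
      have h2 := M.natRk_insert_le (π ⟨j, hjn⟩ : α) (prefixSet π j)
      simp only at h1
      rw [← h1] at h2
      exact ⟨⟨j, hjn⟩, by simp, by simp only; omega, by simp only; omega⟩

theorem exists_natRk_prefixSet_eq {i : ℕ} (h : i ≤ M.natRk M.E) :
    ∃ j, M.natRk (prefixSet π j) = i := by
  cases i with
  | zero => exact ⟨0, by rw [prefixSet_zero, M.natRk_empty]⟩
  | succ i =>
    rw [← prefixSet_of_le π le_rfl] at h
    obtain ⟨j, _, _, hj⟩ := exists_rank_step π h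
    exact ⟨_, hj⟩

omit [M.Finite] in
/-- The ordering `π` generates the flag `X`: the closures of its prefixes are members of `X`. -/
def Generates {k : ℕ} (π : Fin n ≃ M.E) (X : Fin (k + 1) → Set α) : Prop :=
  ∀ j, M.closure (prefixSet π j) ∈ Set.range X

theorem natRk_prefixSet_le (hk : M.eRank = k) (j : ℕ) : M.natRk (prefixSet π j) ≤ k := by
  have h1 : M.natRk M.E = k := M.eRk_eq_iff_natRk.1 (by rw [M.eRk_ground, hk])
  rw [← h1]
  exact M.natRk_mono (prefixSet_subset_ground π j)

variable {π}

theorem Generates.closure_eq {X : Fin (k + 1) → Set α} (h : Generates π X) (hX : IsFlag M X)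
    (j : ℕ) : M.closure (prefixSet π j) = flagAt X (M.natRk (prefixSet π j)) := by
  obtain ⟨i, hi⟩ := h j
  have h1 := hX.natRk_flagAt (Nat.lt_succ_iff.1 i.2)
  rw [flagAt_coe, hi, M.natRk_closure] at h1
  rw [h1, flagAt_coe, hi]

theorem existsUnique_generates (hk : M.eRank = k) (π : Fin n ≃ M.E) :
    ∃! X : Fin (k + 1) → Set α, X ∈ flags M k ∧ Generates π X := by
  have hr : M.natRk M.E = k := M.eRk_eq_iff_natRk.1 (by rw [M.eRk_ground, hk])
  choose J hJ using fun i : Fin (k + 1) =>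
    exists_natRk_prefixSet_eq π (i := i) (by rw [hr]; omega)
  refine ⟨fun i => M.closure (prefixSet π (J i)), ⟨?_, ?_⟩, ?_⟩
  · rw [mem_flags]
    refine isFlag_of_natRk (fun i => ⟨M.isFlat_closure _, by rw [M.natRk_closure, hJ]⟩)
      fun i => M.closure_subset_closure (prefixSet_mono π ?_)
    by_contra hcon
    have h1 := M.natRk_mono (prefixSet_mono π (not_le.1 hcon).le)
    rw [hJ, hJ] at h1
    simp at h1
  · intro j
    have hj := natRk_prefixSet_le π hk j
    refine ⟨⟨M.natRk (prefixSet π j), by omega⟩, ?_⟩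
    have h1 := hJ ⟨M.natRk (prefixSet π j), by omega⟩
    simp only at h1 ⊢
    rcases le_total (J ⟨M.natRk (prefixSet π j), by omega⟩) j with h | h
    · exact M.closure_eq_closure_of_natRk_le (prefixSet_mono π h) h1.ge
    · exact (M.closure_eq_closure_of_natRk_le (prefixSet_mono π h) h1.le).symm
  · rintro X ⟨hX, hg⟩
    rw [mem_flags] at hX
    funext i
    rw [hg.closure_eq hX, hJ, flagAt_coe]

/-- `blk` assigns to each element of the ground set the index of the first member of the flag `X`
that contains it. -/
def IsBlockIndex {k : ℕ} (X : Fin (k + 1) → Set α) (blk : M.E → Fin (k + 1)) : Prop :=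
  ∀ (x : M.E) (i), (x : α) ∈ X i ↔ blk x ≤ i

section BlockIndex

variable {X : Fin (k + 1) → Set α} {blk : M.E → Fin (k + 1)}

omit [M.Finite] in
theorem IsBlockIndex.mem_flagAt_iff (hb : IsBlockIndex X blk) (x : M.E) {i : ℕ} (hi : i ≤ k) :
    (x : α) ∈ flagAt X i ↔ (blk x : ℕ) ≤ i := by
  rw [flagAt_of_le X hi, hb x, Fin.le_def]

theorem Generates.exists_blk_eq (h : Generates π X) (hX : IsFlag M X) (hk : M.eRank = k)
    (hb : IsBlockIndex X blk) {j t : ℕ} (ht : 0 < t) (htj : t ≤ M.natRk (prefixSet π j)) :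
    ∃ j' : Fin n, (j' : ℕ) < j ∧ (blk (π j') : ℕ) = t := by
  obtain ⟨t, rfl⟩ : ∃ s, t = s + 1 := ⟨t - 1, by omega⟩
  obtain ⟨j', h1, h2, h3⟩ := exists_rank_step π htj
  have htk := htj.trans (natRk_prefixSet_le π hk j)
  refine ⟨j', h1, le_antisymm ?_ ?_⟩
  · rw [← hb.mem_flagAt_iff _ htk, ← h3, ← h.closure_eq hX]
    exact M.mem_closure_of_mem ((mem_prefixSet_iff π).2 (by omega)) (prefixSet_subset_ground π _)
  · by_contra hcon
    have h4 : (π j' : α) ∈ flagAt X t := (hb.mem_flagAt_iff _ (by omega)).2 (by omega)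
    rw [← h2, ← h.closure_eq hX] at h4
    have h5 := M.natRk_insert_of_mem_closure h4
    rw [← prefixSet_succ] at h5
    omega

theorem Generates.blk_le_iff (h : Generates π X) (hX : IsFlag M X) (hk : M.eRank = k)
    (hb : IsBlockIndex X blk) (j : Fin n) (j' : ℕ) :
    (blk (π j) : ℕ) ≤ M.natRk (prefixSet π j') ↔ (π j : α) ∈ M.closure (prefixSet π j') := by
  rw [h.closure_eq hX, hb.mem_flagAt_iff _ (natRk_prefixSet_le π hk j')]

theorem generates_iff (hX : IsFlag M X) (hk : M.eRank = k) (hb : IsBlockIndex X blk) :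
    Generates π X ↔
      ∀ j, ∀ t : Fin (k + 1), 0 < t → t < blk (π j) → ∃ j' < j, blk (π j') = t := by
  constructor
  · intro h j t ht htj
    have h1 : (blk (π j) : ℕ) ≤ M.natRk (prefixSet π (j + 1)) :=
      (h.blk_le_iff hX hk hb j _).2 (M.mem_closure_of_mem ((mem_prefixSet_iff π).2 (by omega))
        (prefixSet_subset_ground π _))
    have h2 := M.natRk_insert_le (π j : α) (prefixSet π j)
    rw [← prefixSet_succ] at h2
    obtain ⟨j', h3, h4⟩ := h.exists_blk_eq hX hk hb (j := j) (t := t) ht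
      (by have := Fin.lt_def.1 htj; omega)
    exact ⟨j', h3, Fin.ext h4⟩
  · intro h
    suffices key : ∀ j, ∃ i ≤ k, M.closure (prefixSet π j) = flagAt X i by
      intro j
      obtain ⟨i, hi, h1⟩ := key j
      exact ⟨_, h1.symm⟩
    intro j
    induction j with
    | zero => exact ⟨0, by omega, by rw [prefixSet_zero, hX.flagAt_zero]; rfl⟩
    | succ j ih =>
      obtain ⟨i, hi, hcl⟩ := ih
      by_cases hjn : j < n
      swap
      · refine ⟨i, hi, ?_⟩
        rwa [prefixSet_of_le π (by omega), ← prefixSet_of_le π (not_lt.1 hjn)]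
      have h1 : prefixSet π (j + 1) = insert (π ⟨j, hjn⟩ : α) (prefixSet π j) :=
        prefixSet_succ π ⟨j, hjn⟩
      by_cases hbi : (blk (π ⟨j, hjn⟩) : ℕ) ≤ i
      · refine ⟨i, hi, ?_⟩
        rw [← hb.mem_flagAt_iff _ hi, ← hcl] at hbi
        rw [h1, M.closure_insert_eq_of_mem_closure hbi, hcl]
      -- the block of the next element is the first one not met so far
      have hbi' : (blk (π ⟨j, hjn⟩) : ℕ) = i + 1 := by
        by_contra hcon
        obtain ⟨j', h2, h3⟩ := h ⟨j, hjn⟩ ⟨i + 1, by omega⟩ (Fin.lt_def.2 (Nat.succ_pos i))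
          (Fin.lt_def.2 (by simp only; omega))
        have h4 : (π j' : α) ∈ flagAt X i := by
          rw [← hcl]
          exact M.mem_closure_of_mem ((mem_prefixSet_iff π).2 h2) (prefixSet_subset_ground π _)
        rw [hb.mem_flagAt_iff _ hi, h3] at h4
        simp at h4
      have hik : i + 1 ≤ k := by omega
      refine ⟨i + 1, hik, ?_⟩
      have h2 : prefixSet π (j + 1) ⊆ flagAt X (i + 1) := by
        rw [h1]
        refine Set.insert_subset ((hb.mem_flagAt_iff _ hik).2 hbi'.le) ?_
        refine (M.subset_closure _ (prefixSet_subset_ground π j)).trans ?_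
        rw [hcl]
        exact hX.flagAt_mono (Nat.le_succ i)
      have h3 : (π ⟨j, hjn⟩ : α) ∉ M.closure (prefixSet π j) := by
        rwa [hcl, hb.mem_flagAt_iff _ hi]
      have h4 := M.natRk_insert_of_notMem_closure (π ⟨j, hjn⟩).2 h3
      have h5 : M.natRk (prefixSet π j) = i := by
        rw [← M.natRk_closure, hcl, hX.natRk_flagAt hi]
      rw [M.closure_eq_closure_of_natRk_le h2, (hX.isFlat_flagAt _).closure]
      rw [hX.natRk_flagAt hik, h1]
      omega

theorem Generates.rankSeq_eq (h : Generates π X) (hX : IsFlag M X) (hk : M.eRank = k)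
    (hb : IsBlockIndex X blk) : rankSeq M π = List.ofFn fun j =>
      if blk (π j) ≠ 0 ∧ ∀ j' < j, blk (π j') ≠ blk (π j) then 1 else 0 := by
  rw [_root_.rankSeq_eq]
  congr 1
  funext j
  rw [prefixSet_succ]
  by_cases hj : (blk (π j) : ℕ) ≤ M.natRk (prefixSet π j)
  · rw [M.natRk_insert_of_mem_closure ((h.blk_le_iff hX hk hb j j).1 hj), Nat.sub_self, if_neg]
    rintro ⟨h1, h2⟩
    have h3 : 0 < (blk (π j) : ℕ) := Nat.pos_of_ne_zero fun h => h1 (Fin.ext h)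
    obtain ⟨j', h4, h5⟩ := h.exists_blk_eq hX hk hb h3 hj
    exact h2 j' h4 (Fin.ext h5)
  · have h1 := hj
    rw [h.blk_le_iff hX hk hb] at h1
    rw [M.natRk_insert_of_notMem_closure (π j).2 h1, Nat.add_sub_cancel_left, if_pos]
    refine ⟨fun h0 => hj (by rw [h0]; exact Nat.zero_le _), fun j' hj' heq => hj ?_⟩
    rw [← heq, h.blk_le_iff hX hk hb]
    exact M.mem_closure_of_mem ((mem_prefixSet_iff π).2 hj') (prefixSet_subset_ground π _)

/-- The ground set is the disjoint union of the blocks of a flag. -/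
theorem IsFlag.exists_equiv_blocks (hX : IsFlag M X) (hk : M.eRank = k) :
    ∃ e : M.E ≃ (i : Fin (k + 1)) × Fin (flagComposition X i),
      IsBlockIndex X fun x => (e x).1 := by
  have hex : ∀ x : M.E, ∃ b : Fin (k + 1), ∀ i, (x : α) ∈ X i ↔ b ≤ i := by
    intro x
    have hne : ∃ i : ℕ, (x : α) ∈ flagAt X i := ⟨k, by rw [hX.flagAt_top hk]; exact x.2⟩
    classical
    have hle : Nat.find hne ≤ k := Nat.find_min' hne (by rw [hX.flagAt_top hk]; exact x.2)
    refine ⟨⟨Nat.find hne, by omega⟩, fun i => ?_⟩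
    rw [← flagAt_coe X i]
    exact ⟨fun h => Nat.find_min' hne h, fun h => hX.flagAt_mono h (Nat.find_spec hne)⟩
  choose blk hblk using hex
  have hcard : ∀ i, Nonempty ({x // blk x = i} ≃ Fin (flagComposition X i)) := by
    intro i
    have : Finite M.E := M.ground_finite
    have himg : flagComposition X i = ((↑) '' {x : M.E | blk x = i} : Set α).ncard := by
      have hval : ∀ x : α, (x ∈ ((↑) '' {x : M.E | blk x = i} : Set α)) ↔
          ∃ h : x ∈ M.E, blk ⟨x, h⟩ = i := by
        intro x
        simp
      induction i using Fin.cases with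
      | zero =>
        have h1 : flagComposition X 0 = (X 0).ncard := rfl
        rw [h1]
        congr 1
        ext x
        rw [hval]
        constructor
        · intro hx
          have hxE := (hX.1 0).1.subset_ground hx
          exact ⟨hxE, Fin.le_zero_iff.1 ((hblk ⟨x, hxE⟩ 0).1 hx)⟩
        · rintro ⟨hxE, h⟩
          exact (hblk ⟨x, hxE⟩ 0).2 h.le
      | succ i =>
        have h1 : flagComposition X i.succ = (X i.succ \ X i.castSucc).ncard := rfl
        rw [h1]
        congr 1
        ext x
        rw [hval]
        constructor
        · rintro ⟨hx, hx'⟩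
          have hxE := (hX.1 _).1.subset_ground hx
          rw [hblk ⟨x, hxE⟩] at hx hx'
          refine ⟨hxE, le_antisymm hx ?_⟩
          rw [not_le] at hx'
          exact Fin.castSucc_lt_iff_succ_le.1 hx'
        · rintro ⟨hxE, h⟩
          refine ⟨(hblk ⟨x, hxE⟩ _).2 h.le, fun hx' => ?_⟩
          rw [hblk ⟨x, hxE⟩, h] at hx'
          exact absurd hx' (not_le.2 Fin.castSucc_lt_succ)
    rw [Set.ncard_image_of_injective _ Subtype.val_injective] at himg
    exact ⟨Finite.equivFinOfCardEq (by rw [himg]; rfl)⟩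
  refine ⟨(Equiv.sigmaFiberEquiv blk).symm.trans
    (Equiv.sigmaCongrRight fun i => (hcard i).some), fun x i => ?_⟩
  rw [hblk x i]
  rfl

end BlockIndex

/-- The `𝒢`-invariant is the sum of the contributions of the flags. -/
theorem gInvariant_eq_sum_flags (K : Type w) [Field K] (M : Matroid α) [M.Finite] {k : ℕ}
    (hk : M.eRank = k) :
    gInvariant K M = ∑ X ∈ flags M k, gammaVec K (flagComposition X) := by
  classical
  unfold gInvariant
  let _ : Fintype M.E := M.ground_finite.fintype
  rw [Finset.sum_eq_sum_of_existsUnique _ (flags M k) (fun π X => Generates π X) _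
    fun π _ => existsUnique_generates hk π]
  refine Finset.sum_congr rfl fun X hX => ?_
  rw [mem_flags] at hX
  obtain ⟨e, he⟩ := hX.exists_equiv_blocks hk
  have hn : M.E.ncard = ∑ i, flagComposition X i := by
    rw [hX.sum_flagComposition, hX.flagAt_top hk]
  unfold gammaVec
  refine Finset.sum_equiv (Equiv.equivCongr (finCongr hn) e) (fun π => ?_) fun π hπ => ?_
  · simp only [Finset.mem_filter, Finset.mem_univ, true_and]
    rw [generates_iff hX hk he]
    constructor
    · intro h j t ht htj
      obtain ⟨j', h1, h2⟩ := h ((finCongr hn).symm j) t ht htj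
      exact ⟨finCongr hn j', h1, h2⟩
    · intro h j t ht htj
      obtain ⟨j', h1, h2⟩ := h (finCongr hn j) t ht htj
      exact ⟨(finCongr hn).symm j', h1, h2⟩
  · rw [Finset.mem_filter] at hπ
    rw [hπ.2.rankSeq_eq hX hk he, List.ofFn_congr hn]
    congr 1
    unfold blockSeq
    congr 1
    funext j
    refine if_congr (and_congr Iff.rfl ?_) rfl rfl
    constructor
    · intro h j' hj'
      exact h ((finCongr hn).symm j') hj'
    · intro h j' hj'
      exact h (finCongr hn j') hj'

end Orderings

/-! ### Linear independence of the `γ`-vectors -/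

/-- A family of finitely supported functions that is triangular with respect to a weight is
linearly independent. -/
theorem linearIndependent_of_triangular {K : Type w} [Field K] {ι S : Type*} (v : ι → S →₀ K)
    (key : ι → S) (wt : ι → ℕ) (hdiag : ∀ i, v i (key i) ≠ 0)
    (htri : ∀ i j, j ≠ i → v j (key i) ≠ 0 → wt i < wt j) : LinearIndependent K v := by
  classical
  rw [linearIndependent_iff']
  intro s g hg
  by_contra! hcon
  obtain ⟨i₀, hi₀, hgi₀⟩ := hcon
  obtain ⟨i, hi, hmax⟩ := Finset.exists_max_image (s.filter fun i => g i ≠ 0) wt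
    ⟨i₀, Finset.mem_filter.2 ⟨hi₀, hgi₀⟩⟩
  rw [Finset.mem_filter] at hi
  have h1 : (∑ j ∈ s, g j • v j) (key i) = g i * v i (key i) := by
    rw [Finsupp.finsetSum_apply, Finset.sum_eq_single_of_mem i hi.1]
    · rfl
    · intro j hj hji
      by_contra hne
      simp only [Finsupp.smul_apply, smul_eq_mul, mul_eq_zero, not_or] at hne
      have h2 := hmax j (Finset.mem_filter.2 ⟨hj, hne.1⟩)
      have h3 := htri i j hji hne.2
      omega
  rw [hg] at h1
  exact mul_ne_zero hi.2 (hdiag i) h1.symm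

section Gamma

variable {k : ℕ}

/-- The partial sum `a_0 + ⋯ + a_i` of a composition. -/
def partialSum (a : Fin (k + 1) → ℕ) (i : ℕ) : ℕ := ∑ l ∈ Finset.range (i + 1), entry a l

theorem entry_coe (a : Fin (k + 1) → ℕ) (i : Fin (k + 1)) : entry a i = a i := dif_pos i.2

theorem partialSum_last (a : Fin (k + 1) → ℕ) : partialSum a k = ∑ i, a i := by
  rw [partialSum, Finset.sum_range]
  simp_rw [entry_coe]

/-- The blocks `1, …, k` met among the first `t` elements of an ordering. -/
def metBlocks {a : Fin (k + 1) → ℕ} (π : Fin (∑ i, a i) ≃ (i : Fin (k + 1)) × Fin (a i))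
    (t : ℕ) : Finset (Fin (k + 1)) :=
  open Classical in {i | i ≠ 0 ∧ ∃ j : Fin (∑ i, a i), (j : ℕ) < t ∧ (π j).1 = i}

/-- The number of ones among the first `t` entries of a sequence. -/
def onesBefore (s : List ℕ) (t : ℕ) : ℕ :=
  ((Finset.range t).filter fun j => s.getD j 0 = 1).card

/-- The ones of the sequence of an ordering mark the first elements of the blocks `1, …, k`. -/
theorem onesBefore_blockSeq {a : Fin (k + 1) → ℕ}
    (π : Fin (∑ i, a i) ≃ (i : Fin (k + 1)) × Fin (a i)) (t : ℕ) :
    onesBefore (blockSeq π) t = (metBlocks π t).card := by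
  classical
  have hget : ∀ j : ℕ, (blockSeq π).getD j 0 = 1 ↔ ∃ h : j < ∑ i, a i,
      (π ⟨j, h⟩).1 ≠ 0 ∧ ∀ j' < (⟨j, h⟩ : Fin _), (π j').1 ≠ (π ⟨j, h⟩).1 := by
    intro j
    by_cases h : j < ∑ i, a i
    · rw [List.getD_eq_getElem _ _ (by simpa [blockSeq] using h)]
      simp only [blockSeq, List.getElem_ofFn]
      rw [ite_eq_left_iff]
      simp [h]
    · rw [List.getD_eq_default _ _ (by simpa [blockSeq] using h)]
      simp [h]
  unfold onesBefore
  refine Finset.card_bij (fun j hj => (π ⟨j, ((hget j).1 (Finset.mem_filter.1 hj).2).1⟩).1)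
    ?_ ?_ ?_
  · intro j hj
    obtain ⟨h, h1, h2⟩ := (hget j).1 (Finset.mem_filter.1 hj).2
    exact Finset.mem_filter.2 ⟨Finset.mem_univ _, h1, ⟨j, h⟩,
      Finset.mem_range.1 (Finset.mem_filter.1 hj).1, rfl⟩
  · intro j hj j' hj' heq
    obtain ⟨h, h1, h2⟩ := (hget j).1 (Finset.mem_filter.1 hj).2
    obtain ⟨h', h1', h2'⟩ := (hget j').1 (Finset.mem_filter.1 hj').2
    rcases lt_trichotomy j j' with hlt | hlt | hlt
    · exact absurd heq (h2' ⟨j, h⟩ hlt)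
    · exact hlt
    · exact absurd heq.symm (h2 ⟨j', h'⟩ hlt)
  · intro i hi
    obtain ⟨hi0, hex⟩ := (Finset.mem_filter.1 hi).2
    obtain ⟨j, ⟨hjt, hj⟩, hmin⟩ := exists_minimal_of_wellFoundedLT
      (fun j : Fin (∑ i, a i) => (j : ℕ) < t ∧ (π j).1 = i) hex
    refine ⟨j, Finset.mem_filter.2 ⟨Finset.mem_range.2 hjt, (hget j).2
      ⟨j.2, by rwa [hj], ?_⟩⟩, hj⟩
    intro j' hj' heq
    rw [hj] at heq
    exact absurd (hmin ⟨by have := Fin.lt_def.1 hj'; simp only at this; omega, heq⟩ hj'.le)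
      (not_le.2 hj')

/-- The ordering that lists the blocks one after the other. -/
def blockOrder (a : Fin (k + 1) → ℕ) : Fin (∑ i, a i) ≃ (i : Fin (k + 1)) × Fin (a i) :=
  finSigmaFinEquiv.symm

theorem blockOrder_symm_apply (a : Fin (k + 1) → ℕ) (p : (i : Fin (k + 1)) × Fin (a i)) :
    (((blockOrder a).symm p : Fin _) : ℕ) = ∑ l ∈ Finset.range p.1, entry a l + p.2 := by
  unfold blockOrder
  rw [Equiv.symm_symm, finSigmaFinEquiv_apply, Finset.sum_range]
  congr 1
  refine Finset.sum_congr rfl fun i _ => ?_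
  exact (entry_coe a _).symm

theorem blockOrder_le_iff (a : Fin (k + 1) → ℕ) (j : Fin (∑ i, a i)) (i : ℕ) :
    ((blockOrder a j).1 : ℕ) ≤ i ↔ (j : ℕ) < partialSum a i := by
  obtain ⟨p, rfl⟩ := (blockOrder a).symm.surjective j
  rw [Equiv.apply_symm_apply, blockOrder_symm_apply]
  constructor
  · intro h
    have h1 : ∑ l ∈ Finset.range (p.1 + 1), entry a l ≤ partialSum a i :=
      Finset.sum_le_sum_of_subset (Finset.range_mono (by omega))
    rw [Finset.sum_range_succ, entry_coe] at h1
    have := p.2.2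
    omega
  · intro h
    by_contra hcon
    have h1 : partialSum a i ≤ ∑ l ∈ Finset.range p.1, entry a l :=
      Finset.sum_le_sum_of_subset (Finset.range_mono (by omega))
    omega

theorem adapted_blockOrder {a : Fin (k + 1) → ℕ} (ha : ∀ i : Fin k, 0 < a i.succ) :
    Adapted (blockOrder a) := by
  intro j t ht htj
  obtain ⟨t, rfl⟩ := Fin.exists_succ_eq.2 ht.ne'
  refine ⟨(blockOrder a).symm ⟨t.succ, ⟨0, ha t⟩⟩, ?_, by simp⟩
  by_contra hcon
  have h1 := (blockOrder_le_iff a ((blockOrder a).symm ⟨t.succ, ⟨0, ha t⟩⟩) t.succ).1 (by simp)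
  have h2 := (blockOrder_le_iff a j t.succ).2 (by
    have := Fin.le_def.1 (not_lt.1 hcon)
    omega)
  have := Fin.lt_def.1 htj
  omega

theorem card_metBlocks_blockOrder {a : Fin (k + 1) → ℕ} (ha : ∀ i : Fin k, 0 < a i.succ) {i : ℕ}
    (hi : i ≤ k) : (metBlocks (blockOrder a) (partialSum a i)).card = i := by
  have h : metBlocks (blockOrder a) (partialSum a i) = Finset.Ioc 0 ⟨i, by omega⟩ := by
    ext l
    simp only [metBlocks, Finset.mem_filter, Finset.mem_univ, true_and, Finset.mem_Ioc]
    constructor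
    · rintro ⟨hl, j, hj, rfl⟩
      exact ⟨Fin.pos_iff_ne_zero.2 hl, Fin.le_def.2 ((blockOrder_le_iff a j i).2 hj)⟩
    · rintro ⟨hl, hli⟩
      refine ⟨hl.ne', ?_⟩
      obtain ⟨t, rfl⟩ := Fin.exists_succ_eq.2 hl.ne'
      refine ⟨(blockOrder a).symm ⟨t.succ, ⟨0, ha t⟩⟩, ?_, by simp⟩
      rw [← blockOrder_le_iff]
      simpa using Fin.le_def.1 hli
  rw [h, Fin.card_Ioc]
  simp

theorem card_metBlocks_sum {a : Fin (k + 1) → ℕ} (ha : ∀ i : Fin k, 0 < a i.succ)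
    (π : Fin (∑ i, a i) ≃ (i : Fin (k + 1)) × Fin (a i)) :
    (metBlocks π (∑ i, a i)).card = k := by
  have h : metBlocks π (∑ i, a i) = Finset.Ioi 0 := by
    ext l
    simp only [metBlocks, Finset.mem_filter, Finset.mem_univ, true_and, Finset.mem_Ioi]
    refine ⟨fun h => Fin.pos_iff_ne_zero.2 h.1, fun hl => ⟨hl.ne', ?_⟩⟩
    obtain ⟨t, rfl⟩ := Fin.exists_succ_eq.2 hl.ne'
    exact ⟨π.symm ⟨t.succ, ⟨0, ha t⟩⟩, Fin.is_lt _, by simp⟩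
  rw [h, Fin.card_Ioi]
  simp

/-- If an adapted ordering meets only `i` blocks with its first `t` elements, then these elements
lie in the blocks `0, …, i`. -/
theorem Adapted.le_partialSum {b : Fin (k + 1) → ℕ}
    {π : Fin (∑ i, b i) ≃ (i : Fin (k + 1)) × Fin (b i)} (hπ : Adapted π) {t i : ℕ}
    (ht : t ≤ ∑ i, b i) (h : (metBlocks π t).card ≤ i) : t ≤ partialSum b i := by
  have hle : ∀ j : Fin (∑ i, b i), (j : ℕ) < t → ((π j).1 : ℕ) ≤ i := by
    intro j hj
    by_contra hcon
    have h1 : Finset.Ioc 0 (π j).1 ⊆ metBlocks π t := by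
      intro l hl
      rw [Finset.mem_Ioc] at hl
      refine Finset.mem_filter.2 ⟨Finset.mem_univ _, hl.1.ne', ?_⟩
      rcases hl.2.lt_or_eq with h2 | h2
      · obtain ⟨j', h3, h4⟩ := hπ j l hl.1 h2
        exact ⟨j', by have := Fin.lt_def.1 h3; omega, h4⟩
      · exact ⟨j, hj, h2.symm⟩
    have h2 := Finset.card_le_card h1
    rw [Fin.card_Ioc] at h2
    simp at h2
    omega
  -- compare with the ordering that lists the blocks one after the other
  have hinj : Function.Injective fun j : Fin t =>
      (blockOrder b).symm (π ⟨j, j.2.trans_le ht⟩) := by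
    intro j j' hjj
    have := π.injective ((blockOrder b).symm.injective hjj)
    exact Fin.ext (Fin.mk.inj_iff.1 this)
  have hlt : ∀ j : Fin t,
      ((blockOrder b).symm (π ⟨j, j.2.trans_le ht⟩) : ℕ) < partialSum b i := by
    intro j
    rw [← blockOrder_le_iff, Equiv.apply_symm_apply]
    exact hle _ j.2
  have := Fintype.card_le_of_injective
    (fun j : Fin t => (⟨_, hlt j⟩ : Fin (partialSum b i)))
    fun j j' hjj => hinj (Fin.ext (Fin.mk.inj_iff.1 hjj))
  simpa using this

theorem gammaVec_apply_ne_zero_iff (K : Type w) [Field K] [CharZero K] (a : Fin (k + 1) → ℕ)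
    (s : List ℕ) : gammaVec K a s ≠ 0 ↔
      ∃ π : Fin (∑ i, a i) ≃ (i : Fin (k + 1)) × Fin (a i), Adapted π ∧ blockSeq π = s := by
  classical
  unfold gammaVec
  rw [Finsupp.finsetSum_apply]
  simp_rw [Finsupp.single_apply]
  rw [Finset.sum_boole, Nat.cast_ne_zero, Finset.card_ne_zero]
  simp [Finset.Nonempty]

/-- The compositions of arbitrary size and length whose entries after the first are positive. -/
abbrev AnyComposition : Type := (k : ℕ) × {a : Fin (k + 1) → ℕ // ∀ i : Fin k, 0 < a i.succ}

/-- The `γ`-vectors are linearly independent: the sequence of the ordering that lists the blocks of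
`a` one after the other occurs in `γ(b)` only if `a` and `b` have the same size and length and the
partial sums of `a` are at most those of `b`. -/
theorem linearIndependent_gammaVec (K : Type w) [Field K] [CharZero K] :
    LinearIndependent K fun c : AnyComposition => gammaVec K c.2.1 := by
  refine linearIndependent_of_triangular _ (fun c => blockSeq (blockOrder c.2.1))
    (fun c => ∑ i ∈ Finset.range (c.1 + 1), partialSum c.2.1 i) ?_ ?_
  · rintro ⟨k, a, ha⟩
    exact (gammaVec_apply_ne_zero_iff K a _).2 ⟨blockOrder a, adapted_blockOrder ha, rfl⟩
  · rintro ⟨k, a, ha⟩ ⟨l, b, hb⟩ hne h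
    obtain ⟨π, hπ, hs⟩ := (gammaVec_apply_ne_zero_iff K b _).1 h
    simp only at π hπ hs
    have hn : ∑ i, b i = ∑ i, a i := by simpa [blockSeq] using congrArg List.length hs
    have hcount : ∀ t, (metBlocks π t).card = (metBlocks (blockOrder a) t).card := fun t => by
      rw [← onesBefore_blockSeq, hs, onesBefore_blockSeq]
    obtain rfl : l = k := by
      have := hcount (∑ i, b i)
      rw [card_metBlocks_sum hb, hn, card_metBlocks_sum ha] at this
      exact this
    have hps : ∀ i ≤ l, partialSum a i ≤ partialSum b i := by
      intro i hi
      refine hπ.le_partialSum ?_ (by rw [hcount, card_metBlocks_blockOrder ha hi])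
      rw [hn, ← partialSum_last]
      exact Finset.sum_le_sum_of_subset (Finset.range_mono (by omega))
    refine Finset.sum_lt_sum (fun i hi => hps i (Nat.lt_succ_iff.1 (Finset.mem_range.1 hi))) ?_
    by_contra! hcon
    have heq : ∀ i ≤ l, partialSum a i = partialSum b i := fun i hi =>
      le_antisymm (hps i hi) (hcon i (Finset.mem_range.2 (Nat.lt_succ_of_le hi)))
    apply hne
    congr 2
    funext i
    rw [← entry_coe b, ← entry_coe a]
    rcases Nat.eq_zero_or_pos (i : ℕ) with h0 | h0
    · have := heq 0 (Nat.zero_le _)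
      simp only [partialSum, zero_add, Finset.sum_range_one] at this
      rw [h0, this]
    · have h1 := heq i (by omega)
      have h2 := heq (i - 1) (by omega)
      unfold partialSum at h1 h2
      rw [Finset.sum_range_succ, Finset.sum_range_succ] at h1
      rw [show (i : ℕ) - 1 + 1 = i by omega] at h2
      omega

/-- A linear map can be prescribed on the `γ`-vectors. -/
theorem exists_linearMap_gammaVec (K : Type w) [Field K] [CharZero K]
    (f : ∀ k : ℕ, (Fin (k + 1) → ℕ) → GSpace K) :
    ∃ Φ : GSpace K →ₗ[K] GSpace K, ∀ (n k : ℕ), ∀ a ∈ compositions n k,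
      Φ (gammaVec K a) = f k a := by
  have hli := linearIndependent_gammaVec K
  obtain ⟨Φ, hΦ⟩ := LinearMap.exists_extend
    ((Module.Basis.span hli).constr K fun c : AnyComposition => f c.1 c.2.1)
  refine ⟨Φ, fun n k a ha => ?_⟩
  have h1 := LinearMap.congr_fun hΦ (Module.Basis.span hli ⟨k, a, (Finset.mem_filter.1 ha).2⟩)
  rw [Module.Basis.constr_basis, LinearMap.comp_apply, Submodule.subtype_apply,
    Module.Basis.span_apply] at h1
  exact h1

end Gamma

/-! ### Ranks in the free cone -/

section ConeSets

variable {α : Type u} {m : ℕ}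

open ConeElt

theorem coneProj_insert_base (e : α) (A : Set (ConeElt α m)) :
    coneProj (insert (base e) A) = insert e (coneProj A) := by
  ext x; simp [coneProj, or_assoc]

theorem coneProj_insert_copy (e : α) (j : Fin m) (A : Set (ConeElt α m)) :
    coneProj (insert (copy e j) A) = insert e (coneProj A) := by
  ext x
  simp only [coneProj, Set.mem_insert_iff, Set.mem_ofPred_eq, reduceCtorEq, false_or,
    copy.injEq]
  constructor
  · rintro (h | ⟨i, ⟨h, -⟩ | h⟩)
    exacts [Or.inr (Or.inl h), Or.inl h, Or.inr (Or.inr ⟨i, h⟩)]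
  · rintro (h | h | ⟨i, h⟩)
    exacts [Or.inr ⟨j, Or.inl ⟨h, rfl⟩⟩, Or.inl h, Or.inr ⟨i, Or.inr h⟩]

theorem coneProj_insert_tip (A : Set (ConeElt α m)) :
    coneProj (insert tip A) = coneProj A := by
  ext x; simp [coneProj]

theorem preimage_insert_base (e : α) (A : Set (ConeElt α m)) :
    base ⁻¹' (insert (base e) A) = insert e (base ⁻¹' A) := by
  ext x; simp

theorem preimage_insert_of_notMem {z : ConeElt α m} (hz : z ∉ Set.range base)
    (A : Set (ConeElt α m)) : base ⁻¹' (insert z A) = base ⁻¹' A := by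
  ext x
  simp only [Set.mem_preimage, Set.mem_insert_iff, or_iff_right_iff_imp]
  exact fun h => absurd ⟨x, h⟩ hz

theorem preimage_subset_coneProj (A : Set (ConeElt α m)) : base ⁻¹' A ⊆ coneProj A :=
  fun _ h => Or.inl h

@[simp] theorem coneProj_coneSet (S : Set α) : coneProj (coneSet m S) = S :=
  subset_antisymm (coneProj_subset subset_rfl) fun e he => Or.inl (Or.inl ⟨e, he, rfl⟩)

@[simp] theorem preimage_coneSet (S : Set α) : base ⁻¹' (coneSet m S) = S := by
  ext e; simp [coneSet]

@[simp] theorem base_mem_coneSet {S : Set α} {e : α} :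
    (base e : ConeElt α m) ∈ coneSet m S ↔ e ∈ S := by
  simp [coneSet]

@[simp] theorem copy_mem_coneSet {S : Set α} {e : α} {j : Fin m} :
    (copy e j : ConeElt α m) ∈ coneSet m S ↔ e ∈ S := by
  simp [coneSet]

@[simp] theorem tip_mem_coneSet {S : Set α} : (tip : ConeElt α m) ∈ coneSet m S := by
  simp [coneSet]

theorem copy_notMem_range (e : α) (j : Fin m) : (copy e j : ConeElt α m) ∉ Set.range base := by
  simp

theorem tip_notMem_range : (tip : ConeElt α m) ∉ Set.range base := by simp

theorem ncard_eq_add {A : Set (ConeElt α m)} (hA : A.Finite) :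
    A.ncard = (base ⁻¹' A).ncard + (A \ Set.range base).ncard := by
  rw [← Set.ncard_inter_add_ncard_sdiff_eq_ncard A (Set.range base) hA,
    ← Set.ncard_image_of_injective (base ⁻¹' A) base_injective,
    Set.image_preimage_eq_inter_range]

/-- The element of the original matroid below an element of the cone, if there is one. -/
def ConeElt.below : ConeElt α m → Option α
  | base e => some e
  | copy e _ => some e
  | tip => none

theorem image_coneProj_subset (A : Set (ConeElt α m)) :
    some '' coneProj A ⊆ ConeElt.below '' (A \ {tip}) := by
  rintro _ ⟨e, he | ⟨j, hj⟩, rfl⟩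
  · exact ⟨base e, ⟨he, by simp⟩, rfl⟩
  · exact ⟨copy e j, ⟨hj, by simp⟩, rfl⟩

theorem coneProj_finite {A : Set (ConeElt α m)} (hA : A.Finite) : (coneProj A).Finite :=
  ((hA.sdiff.image _).subset (image_coneProj_subset A)).of_finite_image
    (Option.some_injective α).injOn

theorem ncard_coneProj_le {A : Set (ConeElt α m)} (hA : A.Finite) :
    (coneProj A).ncard ≤ (A \ {tip}).ncard := by
  rw [← Set.ncard_image_of_injective (coneProj A) (Option.some_injective α)]
  exact (Set.ncard_le_ncard (image_coneProj_subset A) (hA.sdiff.image _)).trans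
    (Set.ncard_image_le hA.sdiff)

theorem coneProj_image_base (S : Set α) : coneProj (base '' S : Set (ConeElt α m)) = S := by
  ext e; simp [coneProj]

theorem coneProj_eq_union (A : Set (ConeElt α m)) :
    coneProj A = base ⁻¹' A ∪ coneProj (A \ Set.range base) := by
  ext e
  simp [coneProj]

end ConeSets

namespace Matroid

theorem Indep.natRk_eq {α : Type u} {M : Matroid α} {I : Set α} (hI : M.Indep I) :
    M.natRk I = I.ncard := by
  rw [natRk, hI.eRk_eq_encard, Set.ncard_def]

theorem IsBasis.natRk_eq {α : Type u} {M : Matroid α} {I X : Set α} (hI : M.IsBasis I X) :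
    M.natRk X = I.ncard := by
  rw [← hI.indep.natRk_eq, natRk, natRk, hI.eRk_eq_eRk]

/-- A flat is cyclic when no element is a coloop, in terms of ranks. -/
theorem isCyclicFlat_iff {α : Type u} (M : Matroid α) [M.Finite] {Z : Set α} :
    M.IsCyclicFlat Z ↔ M.IsFlat Z ∧ ∀ e ∈ Z, M.natRk Z ≤ M.natRk (Z \ {e}) := by
  refine and_congr_right fun hZ => forall_congr' fun e => ?_
  rw [restrict_isColoop_iff hZ.subset_ground, not_and', not_not]
  refine forall_congr' fun he => ?_
  have h1 : insert e (Z \ {e}) = Z := by simp [Set.insert_eq_of_mem he]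
  constructor
  · intro h
    have := M.natRk_insert_of_mem_closure h
    rw [h1] at this
    exact this.le
  · intro h
    refine M.mem_closure_of_natRk_insert_le (hZ.subset_ground he) ?_
    rwa [h1]

end Matroid

section Cone

variable {α : Type u} (m : ℕ) (M : Matroid α) [M.Finite]

open ConeElt

theorem freeCone_ground : (freeCone m M).E = coneSet m M.E := rfl

theorem natRk_coneProj_le {A : Set (ConeElt α m)} (hA : A.Finite) :
    M.natRk (coneProj A) ≤ M.natRk (base ⁻¹' A) + ((A \ Set.range base) \ {tip}).ncard := by
  have h1 := M.natRk_union_le (base ⁻¹' A) (coneProj (A \ Set.range base))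
  rw [← coneProj_eq_union] at h1
  have h2 := ncard_coneProj_le (hA.sdiff (t := Set.range base))
  have h3 := M.natRk_le_ncard (coneProj_finite (hA.sdiff (t := Set.range base)))
  omega

/-- Among the defining inequalities of the free cone, only those for the base part and for the
whole set matter. -/
theorem freeCone_indep_iff {I : Set (ConeElt α m)} : (freeCone m M).Indep I ↔
    I ⊆ coneSet m M.E ∧ M.Indep (base ⁻¹' I) ∧ I.ncard ≤ M.natRk (coneProj I) + 1 := by
  have h0 : (freeCone m M).Indep I ↔ ConeIndep m M I := Iff.rfl
  rw [h0, coneIndep_iff]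
  refine and_congr_right fun hIE => ?_
  have hIfin : I.Finite := (coneSet_finite m M.ground_finite).subset hIE
  have hbE : base ⁻¹' I ⊆ M.E := (preimage_subset_coneProj I).trans (coneProj_subset hIE)
  constructor
  · intro h
    constructor
    · have h1 := h (base '' (base ⁻¹' I)) (Set.image_preimage_subset _ _)
      rw [Set.ncard_image_of_injective _ base_injective, coneFun,
        if_pos (Set.image_subset_range _ _), add_zero] at h1
      rw [coneProj_image_base] at h1
      have hf : (base ⁻¹' I).Finite := M.ground_finite.subset hbE
      rw [Matroid.indep_iff_eRk_eq_encard, ← M.natRk_cast, ← hf.cast_ncard_eq]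
      exact_mod_cast le_antisymm (M.natRk_le_ncard hf) h1
    · have h1 := h I subset_rfl
      unfold coneFun at h1
      split_ifs at h1 <;> omega
  · rintro ⟨hb, hcard⟩ A hA
    have hAfin := hIfin.subset hA
    unfold coneFun
    split_ifs with hr
    · have h1 : M.Indep (base ⁻¹' A) := hb.subset (Set.preimage_mono hA)
      have h2 := M.natRk_mono (preimage_subset_coneProj A)
      rw [h1.natRk_eq] at h2
      have h3 := ncard_eq_add hAfin
      rw [Set.sdiff_eq_empty.2 hr, Set.ncard_empty] at h3
      omega
    · have h1 : coneProj I = coneProj A ∪ coneProj (I \ A) := by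
        rw [← coneProj_union, Set.union_sdiff_cancel hA]
      have h2 := M.natRk_union_le (coneProj A) (coneProj (I \ A))
      rw [← h1] at h2
      have h3 := ncard_coneProj_le (hIfin.sdiff (t := A))
      have h4 : (coneProj (I \ A)).Finite := M.ground_finite.subset
        (coneProj_subset (Set.sdiff_subset.trans hIE))
      have h5 := M.natRk_le_ncard h4
      have h6 := Set.ncard_le_ncard (Set.sdiff_subset (s := I \ A) (t := {tip})) hIfin.sdiff
      have h7 := Set.ncard_sdiff_add_ncard_of_subset hA hIfin
      omega

/-- The rank function of the free cone. A basis of `A` that extends a basis of the base part fails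
to contain all other elements of `A` only if the bound for the whole set is attained. -/
theorem natRk_freeCone {A : Set (ConeElt α m)} (hA : A ⊆ coneSet m M.E) :
    (freeCone m M).natRk A =
      min (M.natRk (base ⁻¹' A) + (A \ Set.range base).ncard) (M.natRk (coneProj A) + 1) := by
  have hAfin : A.Finite := (coneSet_finite m M.ground_finite).subset hA
  have hpE : coneProj A ⊆ M.E := coneProj_subset hA
  have hbE : base ⁻¹' A ⊆ M.E := (preimage_subset_coneProj A).trans hpE
  obtain ⟨B, hB⟩ := M.exists_isBasis (base ⁻¹' A)
  have hBfin : B.Finite := M.ground_finite.subset hB.indep.subset_ground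
  have hpre : base ⁻¹' (base '' B : Set (ConeElt α m)) = B :=
    Set.preimage_image_eq B base_injective
  have hB0 : (freeCone m M).Indep (base '' B) := by
    rw [freeCone_indep_iff, hpre, coneProj_image_base, hB.indep.natRk_eq,
      Set.ncard_image_of_injective _ base_injective]
    refine ⟨?_, hB.indep, Nat.le_succ _⟩
    rintro _ ⟨e, he, rfl⟩
    exact base_mem_coneSet.2 (hB.indep.subset_ground he)
  obtain ⟨I, hI, hBI⟩ := hB0.subset_isBasis_of_subset
    (Set.image_subset_iff.2 hB.subset : base '' B ⊆ A) hA
  rw [hI.natRk_eq]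
  obtain ⟨hIE, hIb, hIc⟩ := (freeCone_indep_iff m M).1 hI.indep
  have hIfin := hAfin.subset hI.subset
  have hIb' : base ⁻¹' I = B := by
    refine (hB.eq_of_subset_indep hIb ?_ (Set.preimage_mono hI.subset)).symm
    exact Set.image_subset_iff.1 hBI
  have hIcard := ncard_eq_add hIfin
  rw [hIb', ← hB.natRk_eq] at hIcard
  have hItop := Set.ncard_le_ncard (Set.sdiff_subset_sdiff_left (t := Set.range base) hI.subset)
    hAfin.sdiff
  have hproj := M.natRk_mono (coneProj_mono hI.subset)
  by_cases hex : A \ Set.range base ⊆ I \ Set.range base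
  · have := Set.ncard_le_ncard hex hIfin.sdiff
    omega
  -- otherwise every element outside the basis is blocked by the bound for the whole set
  have hblock : ∀ z ∈ A, z ∉ Set.range base → z ∉ I →
      M.natRk (coneProj (insert z I)) + 1 ≤ I.ncard := by
    intro z hzA hz hzI
    by_contra hcon
    refine hzI (hI.mem_of_insert_indep hzA ((freeCone_indep_iff m M).2
      ⟨Set.insert_subset (hA hzA) hIE, ?_, ?_⟩))
    · rwa [preimage_insert_of_notMem hz]
    · rw [Set.ncard_insert_of_notMem hzI hIfin]
      omega
  obtain ⟨z, ⟨hzA, hz⟩, hzI⟩ := Set.not_subset.1 hex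
  have hz1 := hblock z hzA hz fun h => hzI ⟨h, hz⟩
  have hz2 := M.natRk_mono (coneProj_mono (Set.subset_insert z I))
  have hsub : coneProj A ⊆ M.closure (coneProj I) := by
    rintro e (he | ⟨j, hj⟩)
    · refine M.closure_subset_closure (?_ : B ⊆ _) (hB.subset_closure he)
      rw [← hIb']
      exact preimage_subset_coneProj I
    · by_cases hjI : copy e j ∈ I
      · exact M.mem_closure_of_mem (Or.inr ⟨j, hjI⟩) (coneProj_subset hIE)
      · have h1 := hblock _ hj (copy_notMem_range e j) hjI
        rw [coneProj_insert_copy] at h1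
        exact M.mem_closure_of_natRk_insert_le (hpE (Or.inr ⟨j, hj⟩)) (by omega)
  have h1 := M.natRk_mono hsub
  rw [M.natRk_closure] at h1
  omega

theorem natRk_freeCone_of_tip_mem {A : Set (ConeElt α m)} (hA : A ⊆ coneSet m M.E)
    (ht : tip ∈ A) : (freeCone m M).natRk A = M.natRk (coneProj A) + 1 := by
  have hAfin : A.Finite := (coneSet_finite m M.ground_finite).subset hA
  rw [natRk_freeCone m M hA]
  have h1 := natRk_coneProj_le m M hAfin
  have h2 := Set.ncard_sdiff_singleton_add_one
    (show tip ∈ A \ Set.range base from ⟨ht, tip_notMem_range⟩) hAfin.sdiff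
  omega

theorem natRk_freeCone_le {A : Set (ConeElt α m)} (hA : A ⊆ coneSet m M.E) :
    (freeCone m M).natRk A ≤ M.natRk (base ⁻¹' A) + (A \ Set.range base).ncard := by
  rw [natRk_freeCone m M hA]
  exact min_le_left _ _

theorem natRk_freeCone_coneSet {S : Set α} (hS : S ⊆ M.E) :
    (freeCone m M).natRk (coneSet m S) = M.natRk S + 1 := by
  rw [natRk_freeCone_of_tip_mem m M (coneSet_mono m hS) tip_mem_coneSet, coneProj_coneSet]

/-! ### Flats of the free cone -/

variable {m M}

theorem Matroid.IsFlat.coneSet {F : Set α} (hF : M.IsFlat F) :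
    (freeCone m M).IsFlat (coneSet m F) := by
  refine Matroid.isFlat_of_forall_natRk_lt _ (coneSet_mono m hF.subset_ground) fun z hz hzF => ?_
  rw [freeCone_ground] at hz
  rw [natRk_freeCone_coneSet m M hF.subset_ground, natRk_freeCone_of_tip_mem m M
    (Set.insert_subset hz (coneSet_mono m hF.subset_ground)) (Or.inr tip_mem_coneSet)]
  rcases z with e | ⟨e, j⟩ | _
  · rw [base_mem_coneSet] at hz hzF
    rw [coneProj_insert_base, coneProj_coneSet, hF.natRk_insert hz hzF]
    omega
  · rw [copy_mem_coneSet] at hz hzF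
    rw [coneProj_insert_copy, coneProj_coneSet, hF.natRk_insert hz hzF]
    omega
  · exact absurd tip_mem_coneSet hzF

/-- The flats of the free cone that contain the tip are the cones of flats. -/
theorem isFlat_freeCone_of_tip_mem {Y : Set (ConeElt α m)} (hY : (freeCone m M).IsFlat Y)
    (ht : tip ∈ Y) : M.IsFlat (coneProj Y) ∧ Y = coneSet m (coneProj Y) := by
  have hYE : Y ⊆ coneSet m M.E := hY.subset_ground
  have hpE := coneProj_subset hYE
  have key : coneSet m (M.closure (coneProj Y)) ⊆ Y := by
    intro z hz
    by_contra hzY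
    have hzE := coneSet_mono m (M.closure_subset_ground (coneProj Y)) hz
    have h1 := hY.natRk_insert (e := z) hzE hzY
    rw [natRk_freeCone_of_tip_mem m M hYE ht, natRk_freeCone_of_tip_mem m M
      (Set.insert_subset hzE hYE) (Or.inr ht)] at h1
    have h2 : coneProj (insert z Y) ⊆ M.closure (coneProj Y) := by
      rw [Set.insert_eq, coneProj_union]
      exact Set.union_subset (coneProj_subset (Set.singleton_subset_iff.2 hz))
        (M.subset_closure _ hpE)
    have h3 := M.natRk_mono h2
    rw [M.natRk_closure] at h3
    omega
  have h1 : M.closure (coneProj Y) = coneProj Y := by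
    refine subset_antisymm ?_ (M.subset_closure _ hpE)
    simpa using coneProj_mono key
  rw [h1] at key
  exact ⟨Matroid.isFlat_iff_closure_eq.2 h1, subset_antisymm (subset_coneSet_coneProj Y) key⟩

/-- The flats of the free cone that avoid the tip consist of a flat of `M` and of copies of
elements that are independent over this flat. -/
theorem isFlat_freeCone_iff_of_tip_notMem {Y : Set (ConeElt α m)} (hYE : Y ⊆ coneSet m M.E)
    (ht : tip ∉ Y) : (freeCone m M).IsFlat Y ↔ M.IsFlat (base ⁻¹' Y) ∧
      M.natRk (coneProj Y) = M.natRk (base ⁻¹' Y) + (Y \ Set.range base).ncard := by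
  have hYfin : Y.Finite := (coneSet_finite m M.ground_finite).subset hYE
  have hpE := coneProj_subset hYE
  have hbE : base ⁻¹' Y ⊆ M.E := (preimage_subset_coneProj Y).trans hpE
  have hle := natRk_coneProj_le m M hYfin
  have htop : (Y \ Set.range base) \ {tip} = Y \ Set.range base :=
    Set.sdiff_singleton_eq_self fun h => ht h.1
  rw [htop] at hle
  have hr := natRk_freeCone m M hYE
  constructor
  · intro hY
    -- otherwise the tip lies in the closure
    have heq : M.natRk (coneProj Y) = M.natRk (base ⁻¹' Y) + (Y \ Set.range base).ncard := by
      have h1 := hY.natRk_insert (e := tip) tip_mem_coneSet ht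
      rw [natRk_freeCone_of_tip_mem m M (Set.insert_subset tip_mem_coneSet hYE)
        (Set.mem_insert _ _), coneProj_insert_tip] at h1
      omega
    refine ⟨Matroid.isFlat_of_forall_natRk_lt _ hbE fun e he heY => ?_, heq⟩
    have h1 := hY.natRk_insert (e := base e) (base_mem_coneSet.2 he) heY
    have h2 := natRk_freeCone_le m M (Set.insert_subset (base_mem_coneSet.2 he) hYE)
    rw [preimage_insert_base, Set.insert_sdiff_of_mem _ (Set.mem_range_self e)] at h2
    omega
  · rintro ⟨hF, heq⟩
    refine Matroid.isFlat_of_forall_natRk_lt _ hYE fun z hz hzY => ?_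
    rw [freeCone_ground] at hz
    have hr' := natRk_freeCone m M (Set.insert_subset hz hYE)
    have hmono := M.natRk_mono (coneProj_mono (Set.subset_insert z Y))
    by_cases hzb : z ∈ Set.range base
    · obtain ⟨e, rfl⟩ := hzb
      rw [preimage_insert_base, Set.insert_sdiff_of_mem _ (Set.mem_range_self e),
        hF.natRk_insert (base_mem_coneSet.1 hz) hzY] at hr'
      omega
    · rw [preimage_insert_of_notMem hzb, Set.insert_sdiff_of_notMem _ hzb,
        Set.ncard_insert_of_notMem (fun h => hzY h.1) hYfin.sdiff] at hr'
      omega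

theorem natRk_freeCone_of_isFlat {Y : Set (ConeElt α m)} (hY : (freeCone m M).IsFlat Y)
    (ht : tip ∉ Y) :
    (freeCone m M).natRk Y = M.natRk (base ⁻¹' Y) + (Y \ Set.range base).ncard := by
  have hYE : Y ⊆ coneSet m M.E := hY.subset_ground
  have h1 := ((isFlat_freeCone_iff_of_tip_notMem hYE ht).1 hY).2
  rw [natRk_freeCone m M hYE]
  omega

/-! ### Cyclic flats of the free cone -/

theorem natRk_freeCone_image {X : Set α} (hX : X ⊆ M.E) :
    (freeCone m M).natRk (base '' X) = M.natRk X := by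
  have h1 : base '' X ⊆ coneSet m M.E := by
    rintro _ ⟨e, he, rfl⟩
    exact base_mem_coneSet.2 (hX he)
  rw [natRk_freeCone m M h1, Set.preimage_image_eq _ base_injective, coneProj_image_base,
    Set.sdiff_eq_empty.2 (Set.image_subset_range _ _), Set.ncard_empty]
  omega

theorem isFlat_freeCone_image {X : Set α} (hX : M.IsFlat X) :
    (freeCone m M).IsFlat (base '' X) := by
  have h1 : base '' X ⊆ coneSet m M.E := by
    rintro _ ⟨e, he, rfl⟩
    exact base_mem_coneSet.2 (hX.subset_ground he)
  rw [isFlat_freeCone_iff_of_tip_notMem h1 (by simp), Set.preimage_image_eq _ base_injective,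
    coneProj_image_base, Set.sdiff_eq_empty.2 (Set.image_subset_range _ _), Set.ncard_empty]
  exact ⟨hX, rfl⟩

theorem isCyclicFlat_freeCone_image {X : Set α} :
    (freeCone m M).IsCyclicFlat (base '' X) ↔ M.IsCyclicFlat X := by
  rw [Matroid.isCyclicFlat_iff, Matroid.isCyclicFlat_iff]
  have hflat : (freeCone m M).IsFlat (base '' X) ↔ M.IsFlat X := by
    refine ⟨fun h => ?_, isFlat_freeCone_image⟩
    have := ((isFlat_freeCone_iff_of_tip_notMem h.subset_ground (by simp)).1 h).1
    rwa [Set.preimage_image_eq _ base_injective] at this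
  rw [hflat]
  refine and_congr_right fun hX => ?_
  rw [Set.forall_mem_image]
  refine forall₂_congr fun e _ => ?_
  rw [← Set.image_singleton, ← Set.image_sdiff base_injective,
    natRk_freeCone_image hX.subset_ground,
    natRk_freeCone_image (Set.sdiff_subset.trans hX.subset_ground)]

theorem isCyclicFlat_freeCone_coneSet (hm : 1 ≤ m) {F : Set α} (hF : M.IsFlat F) :
    (freeCone m M).IsCyclicFlat (coneSet m F) ↔ F.Nonempty := by
  rw [Matroid.isCyclicFlat_iff]
  constructor
  · rintro ⟨-, h⟩
    rw [Set.nonempty_iff_ne_empty]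
    rintro rfl
    have h1 := h tip tip_mem_coneSet
    have h2 : coneSet m (∅ : Set α) \ {tip} = ∅ := by
      ext z; simp [coneSet]
    rw [h2, natRk_freeCone_coneSet m M hF.subset_ground, (freeCone m M).natRk_empty] at h1
    omega
  · rintro ⟨e, he⟩
    refine ⟨hF.coneSet, fun z hz => ?_⟩
    have hsub : coneSet m F \ {z} ⊆ coneSet m M.E :=
      Set.sdiff_subset.trans (coneSet_mono m hF.subset_ground)
    have hfin : (coneSet m F \ {z}).Finite := (coneSet_finite m M.ground_finite).subset hsub
    have hproj : F ⊆ coneProj (coneSet m F \ {z}) := by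
      intro x hx
      by_cases hxz : base x = z
      · exact Or.inr ⟨⟨0, hm⟩, copy_mem_coneSet.2 hx, by rw [← hxz]; simp⟩
      · exact Or.inl ⟨base_mem_coneSet.2 hx, hxz⟩
    have h1 := M.natRk_mono hproj
    rw [natRk_freeCone_coneSet m M hF.subset_ground]
    by_cases hzt : z = tip
    · subst hzt
      have h2 : base ⁻¹' (coneSet m F \ {tip}) = F := by
        ext x; simp
      have h3 : 0 < ((coneSet m F \ {tip}) \ Set.range base).ncard := by
        rw [Set.ncard_pos hfin.sdiff]
        exact ⟨copy e ⟨0, hm⟩, by simp [he], copy_notMem_range _ _⟩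
      rw [natRk_freeCone m M hsub, h2]
      omega
    · rw [natRk_freeCone_of_tip_mem m M hsub ⟨tip_mem_coneSet, fun h => hzt h.symm⟩]
      omega

theorem cyclicFlatData_freeCone (hm : 1 ≤ m) :
    (freeCone m M).cyclicFlatData = coneData m M := by
  ext ⟨Z, r⟩
  simp only [Matroid.cyclicFlatData, coneData, Set.mem_ofPred_eq, Prod.mk.injEq]
  constructor
  · rintro ⟨hZ, rfl⟩
    have hZE : Z ⊆ coneSet m M.E := hZ.1.subset_ground
    by_cases ht : tip ∈ Z
    · obtain ⟨hF, hZF⟩ := isFlat_freeCone_of_tip_mem hZ.1 ht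
      rw [hZF, isCyclicFlat_freeCone_coneSet hm hF] at hZ
      refine Or.inr ⟨_, hF, hZ, hZF, ?_⟩
      rw [← Matroid.natRk_cast, natRk_freeCone_of_tip_mem m M hZE ht, ← M.natRk_cast]
      push_cast
      rfl
    · have htop : Z \ Set.range base = ∅ := by
        rw [Set.eq_empty_iff_forall_notMem]
        intro z hz
        have hfin : Z.Finite := (coneSet_finite m M.ground_finite).subset hZE
        have h1 := (Matroid.isCyclicFlat_iff _).1 hZ |>.2 z hz.1
        have h2 := natRk_freeCone_le m M (Set.sdiff_subset.trans hZE : Z \ {z} ⊆ _)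
        have h3 := M.natRk_mono (Set.preimage_mono
          (f := base) (Set.sdiff_subset (s := Z) (t := {z})))
        have h4 := Set.ncard_sdiff_singleton_add_one hz hfin.sdiff
        rw [Set.sdiff_sdiff_comm] at h4
        rw [natRk_freeCone_of_isFlat hZ.1 ht] at h1
        omega
      have hZX : Z = base '' (base ⁻¹' Z) := by
        rw [Set.image_preimage_eq_inter_range, Set.inter_eq_left.2 (Set.sdiff_eq_empty.1 htop)]
      refine Or.inl ⟨base ⁻¹' Z, ?_, hZX, ?_⟩
      · rwa [hZX, isCyclicFlat_freeCone_image] at hZ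
      · rw [← Matroid.natRk_cast, natRk_freeCone_of_isFlat hZ.1 ht, htop, Set.ncard_empty,
          add_zero, ← M.natRk_cast]
  · rintro (⟨X, hX, rfl, rfl⟩ | ⟨F, hF, hne, rfl, rfl⟩)
    · refine ⟨isCyclicFlat_freeCone_image.2 hX, ?_⟩
      rw [← Matroid.natRk_cast, ← Matroid.natRk_cast, natRk_freeCone_image hX.1.subset_ground]
    · refine ⟨(isCyclicFlat_freeCone_coneSet hm hF).2 hne, ?_⟩
      rw [← Matroid.natRk_cast, ← Matroid.natRk_cast,
        natRk_freeCone_coneSet m M hF.subset_ground]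
      push_cast
      rfl

end Cone

/-! ### Counting the steps of a flag of the free cone -/

/-- The number of positions up to `i` that do not lie in `C`: those at which the base part of a
flag of the free cone grows. -/
def baseCount (C : Finset ℕ) (i : ℕ) : ℕ := (Finset.Icc 1 i \ C).card

/-- The number of positions up to `i` that lie in `C`: those at which a copy is added to a flag of
the free cone. -/
def copyCount (C : Finset ℕ) (i : ℕ) : ℕ := (Finset.Icc 1 i ∩ C).card

section Counts

variable (C : Finset ℕ)

theorem baseCount_add_copyCount (i : ℕ) : baseCount C i + copyCount C i = i := by
  rw [baseCount, copyCount, Finset.card_sdiff_add_card_inter, Nat.card_Icc]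
  omega

variable {C}

theorem copyCount_zero : copyCount C 0 = 0 := by simp [copyCount]

theorem copyCount_succ_of_mem {i : ℕ} (h : i + 1 ∈ C) :
    copyCount C (i + 1) = copyCount C i + 1 := by
  unfold copyCount
  rw [← Finset.insert_Icc_right_eq_Icc_add_one (by omega), Finset.insert_inter_of_mem h,
    Finset.card_insert_of_notMem]
  simp

theorem copyCount_succ_of_notMem {i : ℕ} (h : i + 1 ∉ C) :
    copyCount C (i + 1) = copyCount C i := by
  unfold copyCount
  rw [← Finset.insert_Icc_right_eq_Icc_add_one (by omega), Finset.insert_inter_of_notMem h]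

theorem baseCount_succ_of_mem {i : ℕ} (h : i + 1 ∈ C) : baseCount C (i + 1) = baseCount C i := by
  have h1 := baseCount_add_copyCount C i
  have h2 := baseCount_add_copyCount C (i + 1)
  have h3 := copyCount_succ_of_mem h
  omega

theorem baseCount_succ_of_notMem {i : ℕ} (h : i + 1 ∉ C) :
    baseCount C (i + 1) = baseCount C i + 1 := by
  have h1 := baseCount_add_copyCount C i
  have h2 := baseCount_add_copyCount C (i + 1)
  have h3 := copyCount_succ_of_notMem h
  omega

theorem baseCount_mono : Monotone (baseCount C) := by
  refine monotone_nat_of_le_succ fun i => ?_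
  by_cases h : i + 1 ∈ C
  · rw [baseCount_succ_of_mem h]
  · rw [baseCount_succ_of_notMem h]; omega

theorem copyCount_mono : Monotone (copyCount C) := by
  refine monotone_nat_of_le_succ fun i => ?_
  by_cases h : i + 1 ∈ C
  · rw [copyCount_succ_of_mem h]; omega
  · rw [copyCount_succ_of_notMem h]

theorem copyCount_of_subset {h : ℕ} (hC : C ⊆ Finset.Icc 1 h) : copyCount C h = C.card := by
  rw [copyCount, Finset.inter_eq_right.2 hC]

theorem baseCount_of_subset {h : ℕ} (hC : C ⊆ Finset.Icc 1 h) :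
    baseCount C h = h - C.card := by
  have h1 := baseCount_add_copyCount C h
  rw [copyCount_of_subset hC] at h1
  omega

theorem card_le_of_subset_Icc {h : ℕ} (hC : C ⊆ Finset.Icc 1 h) : C.card ≤ h := by
  simpa using Finset.card_le_card hC

theorem exists_baseCount_eq {h j : ℕ} (hj : j ≤ baseCount C h) : ∃ i ≤ h, baseCount C i = j := by
  induction h with
  | zero =>
    have := baseCount_add_copyCount C 0
    exact ⟨0, le_rfl, by omega⟩
  | succ h ih =>
    rcases hj.lt_or_eq with hlt | heq
    · have : j ≤ baseCount C h := by
        by_cases hm : h + 1 ∈ C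
        · rw [baseCount_succ_of_mem hm] at hlt; omega
        · rw [baseCount_succ_of_notMem hm] at hlt; omega
      obtain ⟨i, hi, h1⟩ := ih this
      exact ⟨i, by omega, h1⟩
    · exact ⟨h + 1, le_rfl, heq.symm⟩

theorem exists_copyCount_step {h j : ℕ} (hj : j < copyCount C h) :
    ∃ i < h, i + 1 ∈ C ∧ copyCount C i = j := by
  induction h with
  | zero => rw [copyCount_zero] at hj; omega
  | succ h ih =>
    by_cases hlt : j < copyCount C h
    · obtain ⟨i, hi, h1⟩ := ih hlt
      exact ⟨i, by omega, h1⟩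
    · by_cases hm : h + 1 ∈ C
      · rw [copyCount_succ_of_mem hm] at hj
        exact ⟨h, by omega, hm, by omega⟩
      · rw [copyCount_succ_of_notMem hm] at hj; omega

theorem exists_copyCount_eq {h j : ℕ} (hj : j ≤ copyCount C h) : ∃ i ≤ h, copyCount C i = j := by
  rcases hj.lt_or_eq with hlt | heq
  · obtain ⟨i, hi, _, h1⟩ := exists_copyCount_step hlt
    exact ⟨i, hi.le, h1⟩
  · exact ⟨h, le_rfl, heq.symm⟩

theorem copyCount_step_unique {i i' : ℕ} (hi : i + 1 ∈ C) (hi' : i' + 1 ∈ C)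
    (h : copyCount C i = copyCount C i') : i = i' := by
  rcases lt_trichotomy i i' with hlt | heq | hlt
  · have h1 := copyCount_mono (C := C) (show i + 1 ≤ i' from hlt)
    rw [copyCount_succ_of_mem hi] at h1
    omega
  · exact heq
  · have h1 := copyCount_mono (C := C) (show i' + 1 ≤ i from hlt)
    rw [copyCount_succ_of_mem hi'] at h1
    omega

end Counts

/-! ### The flag of the free cone given by a flag and a choice of copies -/

section Copies

variable {α : Type u} {m c : ℕ}

open ConeElt

/-- The first `t` of a sequence of copies. -/
def copies (s : Fin c → α × Fin m) (t : ℕ) : Set (ConeElt α m) :=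
  {z | ∃ j : Fin c, (j : ℕ) < t ∧ z = copy (s j).1 (s j).2}

variable (s : Fin c → α × Fin m)

theorem copies_zero : copies s 0 = ∅ := by simp [copies]

theorem copies_succ (j : Fin c) :
    copies s (j + 1) = insert (copy (s j).1 (s j).2) (copies s j) := by
  ext z
  constructor
  · rintro ⟨i, hi, rfl⟩
    rcases Nat.lt_succ_iff_lt_or_eq.1 hi with h | h
    · exact Or.inr ⟨i, h, rfl⟩
    · exact Or.inl (by rw [Fin.ext h])
  · rintro (rfl | ⟨i, hi, rfl⟩)
    · exact ⟨j, Nat.lt_succ_self _, rfl⟩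
    · exact ⟨i, by omega, rfl⟩

theorem copies_mono : Monotone (copies s) := by
  rintro t t' h z ⟨j, hj, rfl⟩
  exact ⟨j, hj.trans_le h, rfl⟩

theorem copies_finite (t : ℕ) : (copies s t).Finite :=
  (Set.finite_range fun j => (copy (s j).1 (s j).2 : ConeElt α m)).subset
    fun _ ⟨j, _, h⟩ => ⟨j, h.symm⟩

variable {s}

theorem tip_notMem_image_union (B : Set α) (t : ℕ) : tip ∉ base '' B ∪ copies s t := by
  simp [copies]

theorem preimage_image_union (B : Set α) (t : ℕ) : base ⁻¹' (base '' B ∪ copies s t) = B := by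
  ext x; simp [copies]

theorem image_union_sdiff (B : Set α) (t : ℕ) :
    (base '' B ∪ copies s t) \ Set.range base = copies s t := by
  ext z
  constructor
  · rintro ⟨⟨e, _, rfl⟩ | h, h2⟩
    · exact absurd ⟨e, rfl⟩ h2
    · exact h
  · rintro ⟨j, hj, rfl⟩
    exact ⟨Or.inr ⟨j, hj, rfl⟩, copy_notMem_range _ _⟩

theorem coneProj_image_union (B : Set α) (t : ℕ) :
    coneProj (base '' B ∪ copies s t) = B ∪ coneProj (copies s t) := by
  rw [coneProj_eq_union, preimage_image_union, image_union_sdiff]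

theorem coneProj_copies_succ (j : Fin c) :
    coneProj (copies s (j + 1)) = insert (s j).1 (coneProj (copies s j)) := by
  rw [copies_succ, coneProj_insert_copy]

theorem mem_coneProj_copies {x : α} {t : ℕ} :
    x ∈ coneProj (copies s t) ↔ ∃ j : Fin c, (j : ℕ) < t ∧ x = (s j).1 := by
  simp only [coneProj, copies, Set.mem_ofPred_eq, reduceCtorEq, and_false, exists_false, false_or,
    copy.injEq]
  constructor
  · rintro ⟨_, j, hj, h, _⟩
    exact ⟨j, hj, h⟩
  · rintro ⟨j, hj, h⟩
    exact ⟨_, j, hj, h, rfl⟩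

/-- The elements of which copies are chosen lie in consecutive blocks of the flag `X`, from the
block with index `b + 1` on. -/
def IsCopyChoice {k : ℕ} (X : Fin (k + 1) → Set α) (b : ℕ) (s : Fin c → α × Fin m) : Prop :=
  ∀ j : Fin c, (s j).1 ∈ flagAt X (b + j + 1) \ flagAt X (b + j)

variable {M : Matroid α} {k b : ℕ} {X : Fin (k + 1) → Set α}

theorem IsCopyChoice.coneProj_subset (hs : IsCopyChoice X b s) (hX : IsFlag M X) (t : ℕ) :
    coneProj (copies s t) ⊆ flagAt X (b + t) := by
  intro x hx
  obtain ⟨j, hj, rfl⟩ := mem_coneProj_copies.1 hx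
  exact hX.flagAt_mono (by omega) (hs j).1

theorem IsCopyChoice.copy_notMem (hs : IsCopyChoice X b s) (hX : IsFlag M X) (j : Fin c) :
    copy (s j).1 (s j).2 ∉ copies s j := by
  intro h
  exact (hs j).2 (hs.coneProj_subset hX j (Or.inr ⟨_, h⟩))

theorem IsCopyChoice.ncard_copies (hs : IsCopyChoice X b s) (hX : IsFlag M X) {t : ℕ}
    (ht : t ≤ c) : (copies s t).ncard = t := by
  induction t with
  | zero => rw [copies_zero, Set.ncard_empty]
  | succ t ih =>
    have h1 := copies_succ s ⟨t, ht⟩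
    simp only at h1
    rw [h1, Set.ncard_insert_of_notMem (hs.copy_notMem hX ⟨t, ht⟩) (copies_finite s t),
      ih (by omega)]

theorem IsCopyChoice.natRk_union [M.Finite] (hs : IsCopyChoice X b s) (hX : IsFlag M X) {d t : ℕ}
    (hd : d ≤ b) (hdk : d ≤ k) (ht : t ≤ c) :
    M.natRk (flagAt X d ∪ coneProj (copies s t)) = d + t := by
  induction t with
  | zero =>
    have h0 : coneProj (copies s 0) = ∅ := by
      ext x; simp [mem_coneProj_copies]
    rw [h0, Set.union_empty, hX.natRk_flagAt hdk, add_zero]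
  | succ t ih =>
    have h1 : coneProj (copies s (t + 1)) = insert (s ⟨t, ht⟩).1 (coneProj (copies s t)) :=
      coneProj_copies_succ ⟨t, ht⟩
    have h2 : flagAt X d ∪ coneProj (copies s t) ⊆ flagAt X (b + t) :=
      Set.union_subset (hX.flagAt_mono (by omega)) (hs.coneProj_subset hX t)
    rw [h1, Set.union_insert, M.natRk_insert_of_notMem_closure, ih (by omega)]
    · omega
    · exact hX.flagAt_subset_ground _ (hs ⟨t, ht⟩).1
    · intro h
      have h3 := M.closure_subset_closure h2 h
      rw [(hX.isFlat_flagAt _).closure] at h3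
      exact (hs ⟨t, ht⟩).2 h3

end Copies

section ConeFlag

variable {α : Type u} {m k : ℕ}

open ConeElt

/-- The chain of flats of the free cone given by the flag `X` of `M`, the set `C` of the positions
at most `h` at which a copy is added, and the sequence `s` of these copies. -/
def coneChain (X : Fin (k + 1) → Set α) (h : ℕ) (C : Finset ℕ) (s : Fin C.card → α × Fin m)
    (i : ℕ) : Set (ConeElt α m) :=
  if i ≤ h then base '' flagAt X (baseCount C i) ∪ copies s (copyCount C i)
  else coneSet m (flagAt X (i - 1))

/-- The chain `coneChain`, as a flag. -/
def coneFlag (X : Fin (k + 1) → Set α) (h : ℕ) (C : Finset ℕ) (s : Fin C.card → α × Fin m) :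
    Fin (k + 1 + 1) → Set (ConeElt α m) := fun i => coneChain X h C s i

variable {X : Fin (k + 1) → Set α} {h : ℕ} {C : Finset ℕ} {s : Fin C.card → α × Fin m}

theorem flagAt_coneFlag {i : ℕ} (hi : i ≤ k + 1) :
    flagAt (coneFlag X h C s) i = coneChain X h C s i := by
  rw [flagAt_of_le _ hi]; rfl

theorem coneChain_of_le {i : ℕ} (hi : i ≤ h) : coneChain X h C s i =
    base '' flagAt X (baseCount C i) ∪ copies s (copyCount C i) := if_pos hi

theorem coneChain_of_lt {i : ℕ} (hi : h < i) :
    coneChain X h C s i = coneSet m (flagAt X (i - 1)) := if_neg (not_le.2 hi)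

/-- The flag `Y` of the free cone has type `(h, C)`: its last member without the tip has index `h`,
and `C` consists of the positions at most `h` at which a copy is added. -/
def HasConeType (Y : Fin (k + 1 + 1) → Set (ConeElt α m)) (h : ℕ) (C : Finset ℕ) : Prop :=
  (∀ i ≤ k + 1, tip ∈ flagAt Y i ↔ h < i) ∧
    ∀ i < h, i + 1 ∈ C ↔ flagAt Y (i + 1) \ Set.range base ≠ flagAt Y i \ Set.range base

variable {M : Matroid α} [M.Finite]

section Forward

variable (hX : IsFlag M X) (hh : h ≤ k) (hC : C ⊆ Finset.Icc 1 h)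
  (hs : IsCopyChoice X (h - C.card) s)

include hX hs hC

omit [M.Finite] in
theorem coneChain_low_subset {i : ℕ} (hi : i ≤ h) :
    coneChain X h C s i ⊆ coneSet m (flagAt X h) := by
  rw [coneChain_of_le hi]
  have h1 := card_le_of_subset_Icc hC
  have h2 := copyCount_mono (C := C) hi
  rw [copyCount_of_subset hC] at h2
  have h3 := baseCount_add_copyCount C i
  rintro _ (⟨e, he, rfl⟩ | ⟨j, hj, rfl⟩)
  · exact base_mem_coneSet.2 (hX.flagAt_mono (by omega) he)
  · exact copy_mem_coneSet.2 (hX.flagAt_mono (by omega) (hs j).1)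

include hh

theorem isFlat_coneChain_low {i : ℕ} (hi : i ≤ h) :
    (freeCone m M).IsFlat (coneChain X h C s i) ∧
      (freeCone m M).natRk (coneChain X h C s i) = i := by
  have hE : coneChain X h C s i ⊆ coneSet m M.E :=
    (coneChain_low_subset hX hC hs hi).trans (coneSet_mono m (hX.flagAt_subset_ground _))
  have ht : tip ∉ coneChain X h C s i := by
    rw [coneChain_of_le hi]; exact tip_notMem_image_union _ _
  have h2 := copyCount_mono (C := C) hi
  rw [copyCount_of_subset hC] at h2
  have h3 := baseCount_add_copyCount C i
  have h4 := baseCount_mono (C := C) hi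
  rw [baseCount_of_subset hC] at h4
  have hflat : (freeCone m M).IsFlat (coneChain X h C s i) := by
    rw [isFlat_freeCone_iff_of_tip_notMem hE ht, coneChain_of_le hi, preimage_image_union,
      image_union_sdiff, coneProj_image_union, hs.ncard_copies hX h2,
      hs.natRk_union hX h4 (by omega) h2, hX.natRk_flagAt (by omega)]
    exact ⟨hX.isFlat_flagAt _, rfl⟩
  refine ⟨hflat, ?_⟩
  rw [natRk_freeCone_of_isFlat hflat ht, coneChain_of_le hi, preimage_image_union,
    image_union_sdiff, hs.ncard_copies hX h2, hX.natRk_flagAt (by omega), h3]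

theorem isFlag_coneFlag : IsFlag (freeCone m M) (coneFlag X h C s) := by
  refine isFlag_of_natRk (fun i => ?_) fun i => ?_
  · rcases le_or_gt (i : ℕ) h with hi | hi
    · exact isFlat_coneChain_low hX hh hC hs hi
    · simp only [coneFlag]
      rw [coneChain_of_lt hi]
      refine ⟨(hX.isFlat_flagAt _).coneSet, ?_⟩
      rw [natRk_freeCone_coneSet m M (hX.flagAt_subset_ground _), hX.natRk_flagAt (by omega)]
      omega
  · simp only [coneFlag, Fin.val_castSucc, Fin.val_succ]
    rcases lt_trichotomy (i : ℕ) h with hi | hi | hi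
    · rw [coneChain_of_le hi.le, coneChain_of_le hi]
      exact Set.union_subset_union (Set.image_mono
        (hX.flagAt_mono (baseCount_mono (Nat.le_succ _))))
        (copies_mono s (copyCount_mono (Nat.le_succ _)))
    · rw [coneChain_of_lt (show h < (i : ℕ) + 1 by omega), Nat.add_sub_cancel]
      rw [hi]
      exact coneChain_low_subset hX hC hs le_rfl
    · rw [coneChain_of_lt hi, coneChain_of_lt (show h < (i : ℕ) + 1 by omega)]
      exact coneSet_mono m (hX.flagAt_mono (by omega))

omit [M.Finite] in
theorem hasConeType_coneFlag : HasConeType (coneFlag X h C s) h C := by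
  constructor
  · intro i hi
    rw [flagAt_coneFlag hi]
    rcases le_or_gt i h with hih | hih
    · rw [coneChain_of_le hih]
      exact iff_of_false (tip_notMem_image_union _ _) (by omega)
    · rw [coneChain_of_lt hih]
      exact iff_of_true tip_mem_coneSet hih
  · intro i hi
    rw [flagAt_coneFlag (by omega), flagAt_coneFlag (by omega), coneChain_of_le hi.le,
      coneChain_of_le hi, image_union_sdiff, image_union_sdiff]
    by_cases hiC : i + 1 ∈ C
    · refine iff_of_true hiC fun heq => ?_
      have h1 := copyCount_mono (C := C) (show i + 1 ≤ h from hi)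
      rw [copyCount_of_subset hC] at h1
      have h2 := hs.ncard_copies hX h1
      rw [heq, hs.ncard_copies hX ((copyCount_mono (Nat.le_succ i)).trans h1),
        copyCount_succ_of_mem hiC] at h2
      omega
    · rw [copyCount_succ_of_notMem hiC]
      exact iff_of_false hiC fun h => h rfl

/-- The members of `X` in the range of the chosen copies are spanned by the earlier ones and
the copies. -/
theorem flagAt_eq_closure_copies {t : ℕ} (ht : t ≤ C.card) :
    flagAt X (h - C.card + t) =
      M.closure (flagAt X (h - C.card) ∪ coneProj (copies s t)) := by
  have h1 := card_le_of_subset_Icc hC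
  have h2 : flagAt X (h - C.card) ∪ coneProj (copies s t) ⊆ flagAt X (h - C.card + t) :=
    Set.union_subset (hX.flagAt_mono (by omega)) (hs.coneProj_subset hX t)
  rw [M.closure_eq_closure_of_natRk_le h2, (hX.isFlat_flagAt _).closure]
  rw [hX.natRk_flagAt (by omega), hs.natRk_union hX le_rfl (by omega) ht]

end Forward

/-- The flag of `M` and the copies can be read off from the flag of the free cone. -/
theorem coneFlag_injective {X' : Fin (k + 1) → Set α} {s' : Fin C.card → α × Fin m}
    (hX : IsFlag M X) (hX' : IsFlag M X') (hh : h ≤ k) (hC : C ⊆ Finset.Icc 1 h)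
    (hs : IsCopyChoice X (h - C.card) s) (hs' : IsCopyChoice X' (h - C.card) s')
    (heq : coneFlag X h C s = coneFlag X' h C s') : X = X' ∧ s = s' := by
  have hchain : ∀ i ≤ k + 1, coneChain X h C s i = coneChain X' h C s' i := fun i hi => by
    rw [← flagAt_coneFlag hi, heq, flagAt_coneFlag hi]
  have hcard := card_le_of_subset_Icc hC
  have hcopies : ∀ t ≤ C.card, copies s t = copies s' t := by
    intro t ht
    rw [← copyCount_of_subset hC] at ht
    obtain ⟨i, hi, rfl⟩ := exists_copyCount_eq ht
    have h1 := hchain i (by omega)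
    rw [coneChain_of_le hi, coneChain_of_le hi] at h1
    have h2 := congrArg (· \ Set.range base) h1
    simpa only [image_union_sdiff] using h2
  have hlow : ∀ i ≤ h - C.card, flagAt X i = flagAt X' i := by
    intro i hi
    rw [← baseCount_of_subset hC] at hi
    obtain ⟨i, hih, rfl⟩ := exists_baseCount_eq hi
    have h1 := hchain i (by omega)
    rw [coneChain_of_le hih, coneChain_of_le hih] at h1
    have h2 := congrArg (base ⁻¹' ·) h1
    simpa only [preimage_image_union] using h2
  constructor
  · funext i
    rw [← flagAt_coe X, ← flagAt_coe X']
    rcases le_or_gt (i : ℕ) (h - C.card) with hi | hi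
    · exact hlow i hi
    rcases le_or_gt (i : ℕ) h with hi' | hi'
    · obtain ⟨t, ht⟩ : ∃ t, (i : ℕ) = h - C.card + t := ⟨i - (h - C.card), by omega⟩
      rw [ht, flagAt_eq_closure_copies hX hh hC hs (by omega),
        flagAt_eq_closure_copies hX' hh hC hs' (by omega), hlow _ le_rfl, hcopies _ (by omega)]
    · have h1 := hchain (i + 1) (by omega)
      rw [coneChain_of_lt (by omega), coneChain_of_lt (by omega), Nat.add_sub_cancel] at h1
      simpa only [coneProj_coneSet] using congrArg coneProj h1
  · funext j
    have h1 : copy (s j).1 (s j).2 ∈ copies s (j + 1) := ⟨j, Nat.lt_succ_self _, rfl⟩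
    rw [hcopies _ (by omega), copies_succ] at h1
    rcases h1 with h1 | h1
    · rw [copy.injEq] at h1
      exact Prod.ext h1.1 h1.2
    · rw [← hcopies _ (by omega)] at h1
      exact absurd h1 (hs.copy_notMem hX j)

end ConeFlag

/-! ### Every flag of the free cone arises from a flag and a choice of copies -/

section Backward

variable {α : Type u} {m k : ℕ} {M : Matroid α} [M.Finite] {h : ℕ} {C : Finset ℕ}
  {Y : Fin (k + 1 + 1) → Set (ConeElt α m)}

open ConeElt

section Low

variable (hY : IsFlag (freeCone m M) Y) (hh : h ≤ k) (hT : HasConeType Y h C)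

include hh hT

omit [M.Finite] in
theorem HasConeType.tip_notMem {i : ℕ} (hi : i ≤ h) : tip ∉ flagAt Y i := fun ht =>
  absurd ((hT.1 i (by omega)).1 ht) (not_lt.2 hi)

include hY

theorem HasConeType.isFlat_preimage {i : ℕ} (hi : i ≤ h) :
    M.IsFlat (base ⁻¹' flagAt Y i) ∧
      M.natRk (coneProj (flagAt Y i)) = i ∧
      M.natRk (base ⁻¹' flagAt Y i) + (flagAt Y i \ Set.range base).ncard = i := by
  have hflat := hY.isFlat_flagAt i
  have ht := hT.tip_notMem hh hi
  have h1 := (isFlat_freeCone_iff_of_tip_notMem hflat.subset_ground ht).1 hflat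
  have h2 := natRk_freeCone_of_isFlat hflat ht
  rw [hY.natRk_flagAt (by omega)] at h2
  exact ⟨h1.1, h1.2.trans h2.symm, h2.symm⟩

omit hh hT in
theorem flagAt_finite (i : ℕ) : (flagAt Y i).Finite :=
  (coneSet_finite m M.ground_finite).subset (hY.flagAt_subset_ground i)

theorem HasConeType.ncard_sdiff {i : ℕ} (hi : i ≤ h) :
    (flagAt Y i \ Set.range base).ncard = copyCount C i := by
  induction i with
  | zero =>
    have := (hT.isFlat_preimage hY hh (Nat.zero_le h)).2.2
    rw [copyCount_zero]
    omega
  | succ i ih =>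
    have hsub : flagAt Y i \ Set.range base ⊆ flagAt Y (i + 1) \ Set.range base :=
      Set.sdiff_subset_sdiff_left (hY.flagAt_mono (Nat.le_add_right i 1))
    have h1 := (hT.isFlat_preimage hY hh hi).2.2
    have h2 := (hT.isFlat_preimage hY hh (i := i) (by omega)).2.2
    have h3 := M.natRk_mono (Set.preimage_mono (f := base) (hY.flagAt_mono (Nat.le_add_right i 1)))
    by_cases hiC : i + 1 ∈ C
    · have h4 := Set.ncard_lt_ncard
        (hsub.ssubset_of_ne ((hT.2 i hi).1 hiC).symm) (flagAt_finite hY _).sdiff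
      rw [copyCount_succ_of_mem hiC, ← ih (by omega)]
      omega
    · rw [copyCount_succ_of_notMem hiC, ← ih (by omega)]
      congr 1
      by_contra hne
      exact hiC ((hT.2 i hi).2 hne)

theorem HasConeType.natRk_preimage {i : ℕ} (hi : i ≤ h) :
    M.natRk (base ⁻¹' flagAt Y i) = baseCount C i := by
  have h1 := (hT.isFlat_preimage hY hh hi).2.2
  rw [hT.ncard_sdiff hY hh hi] at h1
  have h2 := baseCount_add_copyCount C i
  omega

theorem HasConeType.preimage_subset {i i' : ℕ} (hi : i ≤ h) (hi' : i' ≤ h)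
    (hle : baseCount C i ≤ baseCount C i') : base ⁻¹' flagAt Y i ⊆ base ⁻¹' flagAt Y i' := by
  rcases le_total i i' with h1 | h1
  · exact Set.preimage_mono (hY.flagAt_mono h1)
  · refine ((hT.isFlat_preimage hY hh hi').1.eq_of_subset_of_natRk_le
      (hT.isFlat_preimage hY hh hi).1 (Set.preimage_mono (hY.flagAt_mono h1)) ?_).superset
    rwa [hT.natRk_preimage hY hh hi, hT.natRk_preimage hY hh hi']

theorem HasConeType.exists_copy {i : ℕ} (hi : i < h) (hiC : i + 1 ∈ C) :
    ∃ p : α × Fin m, flagAt Y (i + 1) \ Set.range base =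
      insert (copy p.1 p.2) (flagAt Y i \ Set.range base) := by
  have hsub : flagAt Y i \ Set.range base ⊆ flagAt Y (i + 1) \ Set.range base :=
    Set.sdiff_subset_sdiff_left (hY.flagAt_mono (Nat.le_add_right i 1))
  have h1 := hT.ncard_sdiff hY hh (i := i + 1) hi
  have h2 := hT.ncard_sdiff hY hh hi.le
  rw [copyCount_succ_of_mem hiC] at h1
  obtain ⟨z, -, heq⟩ := (Set.exists_eq_insert_iff_ncard (flagAt_finite hY i).sdiff).2
    ⟨hsub, by rw [h1, h2]⟩
  have hz : z ∈ flagAt Y (i + 1) \ Set.range base := heq ▸ Set.mem_insert _ _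
  have ht := hT.tip_notMem hh (i := i + 1) hi
  rcases z with e | ⟨e, j⟩ | _
  · exact absurd (Set.mem_range_self e) hz.2
  · exact ⟨(e, j), heq.symm⟩
  · exact absurd hz.1 ht

/-- The copies that a flag of the free cone contains, in the order in which they are added. -/
theorem HasConeType.exists_copies (hC : C ⊆ Finset.Icc 1 h) :
    ∃ s : Fin C.card → α × Fin m, ∀ i ≤ h,
      flagAt Y i \ Set.range base = copies s (copyCount C i) := by
  have hstep : ∀ j : Fin C.card, ∃ i < h, i + 1 ∈ C ∧ copyCount C i = j := fun j =>
    exists_copyCount_step (by rw [copyCount_of_subset hC]; exact j.2)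
  choose I hI hIC hIj using hstep
  choose s hs using fun j => hT.exists_copy hY hh (hI j) (hIC j)
  refine ⟨s, fun i hi => ?_⟩
  induction i with
  | zero =>
    rw [copyCount_zero, copies_zero, ← Set.ncard_eq_zero (flagAt_finite hY _).sdiff,
      hT.ncard_sdiff hY hh hi, copyCount_zero]
  | succ i ih =>
    by_cases hiC : i + 1 ∈ C
    · have hlt : copyCount C i < C.card := by
        have := copyCount_mono (C := C) hi
        rw [copyCount_of_subset hC, copyCount_succ_of_mem hiC] at this
        omega
      have hIi : I ⟨copyCount C i, hlt⟩ = i := copyCount_step_unique (hIC _) hiC (hIj _)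
      have h1 := hs ⟨copyCount C i, hlt⟩
      rw [hIi, ih (by omega)] at h1
      rw [h1, copyCount_succ_of_mem hiC]
      exact (copies_succ s ⟨copyCount C i, hlt⟩).symm
    · rw [copyCount_succ_of_notMem hiC, ← ih (by omega)]
      by_contra hne
      exact hiC ((hT.2 i hi).2 hne)

end Low

/-- Every flag of the free cone of type `(h, C)` arises from a flag of `M` and copies. The flag of
`M` consists of the base parts, then of the closures obtained by adding the elements below the
copies one at a time, and finally of the projections of the members with the tip. -/
theorem exists_coneFlag_eq (hY : IsFlag (freeCone m M) Y) (hh : h ≤ k)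
    (hC : C ⊆ Finset.Icc 1 h) (hT : HasConeType Y h C) :
    ∃ (X : Fin (k + 1) → Set α) (s : Fin C.card → α × Fin m), IsFlag M X ∧
      IsCopyChoice X (h - C.card) s ∧ coneFlag X h C s = Y := by
  obtain ⟨s, hs⟩ := hT.exists_copies hY hh hC
  have hcard := card_le_of_subset_Icc hC
  have hbc := baseCount_of_subset hC
  have hcc := copyCount_of_subset hC
  have hex : ∀ j : ℕ, ∃ i ≤ h, j ≤ h - C.card → baseCount C i = j := by
    intro j
    by_cases hj : j ≤ h - C.card
    · rw [← hbc] at hj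
      obtain ⟨i, hi, h1⟩ := exists_baseCount_eq hj
      exact ⟨i, hi, fun _ => h1⟩
    · exact ⟨0, Nat.zero_le _, fun h => absurd h hj⟩
  choose I hI hIj using hex
  -- `B` lists the base parts of the members without the tip
  set B : ℕ → Set α := fun j => base ⁻¹' flagAt Y (I j) with hB
  have hBcount : ∀ i ≤ h, B (baseCount C i) = base ⁻¹' flagAt Y i := by
    intro i hi
    have h1 := hIj (baseCount C i) (by rw [← hbc]; exact baseCount_mono hi)
    exact subset_antisymm (hT.preimage_subset hY hh (hI _) hi h1.le)
      (hT.preimage_subset hY hh hi (hI _) h1.ge)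
  have hBrk : ∀ j ≤ h - C.card, M.natRk (B j) = j := fun j hj => by
    rw [hB, hT.natRk_preimage hY hh (hI j), hIj j hj]
  have hBtop : B (h - C.card) = base ⁻¹' flagAt Y h := by rw [← hBcount h le_rfl, hbc]
  -- `D` adds to the last base part the elements below the copies, in order
  set D : ℕ → Set α := fun t => B (h - C.card) ∪ coneProj (copies s t) with hD
  have hDtop : D C.card = coneProj (flagAt Y h) := by
    rw [hD, coneProj_eq_union (flagAt Y h), hs h le_rfl, hcc, hBtop]
  have hD0 : D 0 = B (h - C.card) := by
    have h0 : coneProj (copies s 0) = ∅ := by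
      ext x; simp [mem_coneProj_copies]
    rw [hD]; simp only [h0, Set.union_empty]
  have hDsucc : ∀ j : Fin C.card, D (j + 1) = insert (s j).1 (D j) := fun j => by
    simp only [hD]
    rw [coneProj_copies_succ, Set.union_insert]
  have hDmono : Monotone D := fun t t' h =>
    Set.union_subset_union_right _ (coneProj_mono (copies_mono s h))
  have hDE : ∀ t ≤ C.card, D t ⊆ M.E := fun t ht => by
    refine (hDmono ht).trans ?_
    rw [hDtop]
    exact coneProj_subset (hY.flagAt_subset_ground _)
  -- the ranks of `D` grow by at most one, and are known at both ends
  have hDrk : ∀ t ≤ C.card, M.natRk (D t) = h - C.card + t := by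
    have hup : ∀ t ≤ C.card, M.natRk (D t) ≤ h - C.card + t := by
      intro t
      induction t with
      | zero => intro _; rw [hD0, hBrk _ le_rfl]; omega
      | succ t ih =>
        intro ht
        have h1 := M.natRk_insert_le (s ⟨t, ht⟩).1 (D t)
        rw [← hDsucc ⟨t, ht⟩] at h1
        have := ih (by omega)
        simp only at h1
        omega
    have hdown : ∀ i ≤ C.card, h ≤ M.natRk (D (C.card - i)) + i := by
      intro i
      induction i with
      | zero =>
        intro _
        rw [Nat.sub_zero, hDtop, (hT.isFlat_preimage hY hh le_rfl).2.1]
        omega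
      | succ i ih =>
        intro hi
        have h1 := M.natRk_insert_le (s ⟨C.card - (i + 1), by omega⟩).1 (D (C.card - (i + 1)))
        rw [← hDsucc ⟨C.card - (i + 1), by omega⟩] at h1
        simp only [show C.card - (i + 1) + 1 = C.card - i by omega] at h1
        have := ih (by omega)
        omega
    intro t ht
    have h1 := hup t ht
    have h2 := hdown (C.card - t) (by omega)
    rw [show C.card - (C.card - t) = t by omega] at h2
    omega
  have htip : ∀ i, h < i → i ≤ k + 1 → M.IsFlat (coneProj (flagAt Y i)) ∧
      flagAt Y i = coneSet m (coneProj (flagAt Y i)) := fun i hi hik =>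
    isFlat_freeCone_of_tip_mem (hY.isFlat_flagAt i) ((hT.1 i hik).2 hi)
  have htiprk : ∀ i, h < i → i ≤ k + 1 → M.natRk (coneProj (flagAt Y i)) + 1 = i := by
    intro i hi hik
    have h1 := natRk_freeCone_coneSet m M (htip i hi hik).1.subset_ground
    rw [← (htip i hi hik).2, hY.natRk_flagAt hik] at h1
    exact h1.symm
  let X' : ℕ → Set α := fun i =>
    if i ≤ h - C.card then B i
    else if i ≤ h then M.closure (D (i - (h - C.card)))
    else coneProj (flagAt Y (i + 1))
  have hXlow : ∀ i ≤ h - C.card, X' i = B i := fun i hi => if_pos hi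
  have hXmid : ∀ t ≤ C.card, X' (h - C.card + t) = M.closure (D t) := by
    intro t ht
    rcases Nat.eq_zero_or_pos t with rfl | h0
    · rw [add_zero, hXlow _ le_rfl, hD0, hBtop, (hT.isFlat_preimage hY hh le_rfl).1.closure]
    · simp only [X']
      rw [if_neg (by omega), if_pos (by omega), Nat.add_sub_cancel_left]
  -- at `h`, where two of the three descriptions meet, both give the same flat
  have hXtop : ∀ i, h ≤ i → i ≤ k → X' i = coneProj (flagAt Y (i + 1)) := by
    intro i hi hik
    rcases hi.eq_or_lt with rfl | hlt
    · have h1 := hXmid C.card le_rfl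
      rw [Nat.sub_add_cancel hcard] at h1
      rw [h1, hDtop]
      have h2 := htip (h + 1) (Nat.lt_succ_self h) (by omega)
      rw [M.closure_eq_closure_of_natRk_le (coneProj_mono (hY.flagAt_mono (Nat.le_add_right h 1))),
        h2.1.closure]
      rw [(hT.isFlat_preimage hY hh le_rfl).2.1]
      have := htiprk (h + 1) (Nat.lt_succ_self h) (by omega)
      omega
    · simp only [X']
      rw [if_neg (by omega), if_neg (by omega)]
  have hcases : ∀ i, i < h - C.card ∨ (∃ t < C.card, i = h - C.card + t) ∨ h ≤ i := by
    intro i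
    rcases lt_or_ge i (h - C.card) with h1 | h1
    · exact Or.inl h1
    rcases lt_or_ge i h with h2 | h2
    · exact Or.inr (Or.inl ⟨i - (h - C.card), by omega, by omega⟩)
    · exact Or.inr (Or.inr h2)
  have hX : IsFlag M (fun i : Fin (k + 1) => X' i) := by
    refine isFlag_of_natRk (fun i => ?_) fun i => ?_
    · rcases hcases i with hi | ⟨t, ht, hi⟩ | hi
      · rw [hXlow _ hi.le]
        exact ⟨(hT.isFlat_preimage hY hh (hI _)).1, hBrk _ hi.le⟩
      · rw [hi, hXmid _ ht.le]
        exact ⟨M.isFlat_closure _, by rw [M.natRk_closure, hDrk _ ht.le]⟩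
      · rw [hXtop _ hi (by omega)]
        refine ⟨(htip _ (by omega) (by omega)).1, ?_⟩
        have := htiprk (i + 1) (by omega) (by omega)
        omega
    · simp only [Fin.val_castSucc, Fin.val_succ]
      rcases hcases i with hi | ⟨t, ht, hi⟩ | hi
      · rw [hXlow _ hi.le, hXlow _ hi]
        refine hT.preimage_subset hY hh (hI _) (hI _) ?_
        rw [hIj _ hi.le, hIj _ hi]
        omega
      · rw [hi, add_assoc, hXmid _ ht.le, hXmid _ ht]
        exact M.closure_subset_closure (hDmono (Nat.le_succ t))
      · rw [hXtop _ hi (by omega), hXtop _ (by omega) (by omega)]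
        exact coneProj_mono (hY.flagAt_mono (Nat.le_succ _))
  have hXat : ∀ i ≤ k, flagAt (fun i : Fin (k + 1) => X' i) i = X' i := fun i hi => by
    rw [flagAt_of_le _ hi]
  refine ⟨fun i => X' i, s, hX, fun j => ?_, ?_⟩
  · have hj := j.2
    rw [hXat _ (by omega), hXat _ (by omega), add_assoc, hXmid _ (by omega), hXmid _ (by omega)]
    refine ⟨M.subset_closure _ (hDE _ (by omega)) ?_, fun hmem => ?_⟩
    · rw [hDsucc]; exact Set.mem_insert _ _
    · have h1 := M.natRk_insert_of_mem_closure hmem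
      rw [← hDsucc, hDrk _ (by omega), hDrk _ (by omega)] at h1
      omega
  · funext i
    rw [← flagAt_coe Y]
    simp only [coneFlag]
    rcases le_or_gt (i : ℕ) h with hi | hi
    · have h1 : baseCount C i ≤ h - C.card := by rw [← hbc]; exact baseCount_mono hi
      rw [coneChain_of_le hi, hXat _ (by omega), hXlow _ h1, hBcount _ hi, ← hs _ hi,
        Set.image_preimage_eq_inter_range, Set.inter_union_sdiff]
    · rw [coneChain_of_lt hi, hXat _ (by omega), hXtop _ (by omega) (by omega),
        Nat.sub_add_cancel (by omega), ← (htip _ hi (by omega)).2]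

/-- Every flag of the free cone has exactly one type; the tip is not in its first member because it
is not a loop. -/
theorem existsUnique_hasConeType (hY : IsFlag (freeCone m M) Y)
    (hk : M.eRank = k) :
    ∃! p : (_ : ℕ) × Finset ℕ,
      p ∈ (Finset.range (k + 1)).sigma (fun h => (Finset.Icc 1 h).powerset) ∧
        HasConeType Y p.1 p.2 := by
  classical
  have hr : M.natRk M.E = k := M.eRk_eq_iff_natRk.1 (by rw [M.eRk_ground, hk])
  have h0 : tip ∉ flagAt Y 0 := by
    intro ht
    have h1 := natRk_freeCone_of_tip_mem m M (hY.flagAt_subset_ground 0) ht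
    rw [hY.natRk_flagAt (Nat.zero_le _)] at h1
    omega
  have htop : tip ∈ flagAt Y (k + 1) := by
    have h1 : flagAt Y (k + 1) = (freeCone m M).E := by
      refine (hY.isFlat_flagAt _).eq_of_subset_of_natRk_le (freeCone m M).ground_isFlat
        (hY.flagAt_subset_ground _) ?_
      rw [hY.natRk_flagAt le_rfl, freeCone_ground, natRk_freeCone_coneSet m M subset_rfl, hr]
    rw [h1]
    exact tip_mem_coneSet
  have hex : ∃ i, tip ∈ flagAt Y (i + 1) := ⟨k, htop⟩
  have hle : Nat.find hex ≤ k := Nat.find_min' hex htop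
  refine ⟨⟨Nat.find hex, (Finset.Icc 1 (Nat.find hex)).filter fun i =>
    flagAt Y i \ Set.range base ≠ flagAt Y (i - 1) \ Set.range base⟩, ⟨?_, ?_, ?_⟩, ?_⟩
  · simp only [Finset.mem_sigma, Finset.mem_range, Finset.mem_powerset]
    exact ⟨by omega, Finset.filter_subset _ _⟩
  · intro i _
    simp only
    constructor
    · intro ht
      cases i with
      | zero => exact absurd ht h0
      | succ i => exact Nat.lt_succ_of_le (Nat.find_min' hex ht)
    · intro hi
      exact hY.flagAt_mono hi (Nat.find_spec hex)
  · intro i hi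
    simp only at hi ⊢
    rw [Finset.mem_filter, Nat.add_sub_cancel, and_iff_right]
    rw [Finset.mem_Icc]
    omega
  · rintro ⟨h', C'⟩ ⟨hmem, hT1, hT2⟩
    simp only [Finset.mem_sigma, Finset.mem_range, Finset.mem_powerset] at hmem hT1 hT2
    have hh' : h' = Nat.find hex := by
      refine le_antisymm ?_ (Nat.find_min' hex ((hT1 _ (by omega)).2 (Nat.lt_succ_self h')))
      exact Nat.lt_succ_iff.1 ((hT1 _ (by omega)).1 (Nat.find_spec hex))
    subst hh'
    congr 1
    ext i
    rw [Finset.mem_filter]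
    constructor
    · intro hi
      have h1 := hmem.2 hi
      refine ⟨h1, ?_⟩
      rw [Finset.mem_Icc] at h1
      have h2 := hT2 (i - 1) (by omega)
      rw [show i - 1 + 1 = i by omega] at h2
      exact h2.1 hi
    · rintro ⟨h1, h3⟩
      rw [Finset.mem_Icc] at h1
      have h2 := hT2 (i - 1) (by omega)
      rw [show i - 1 + 1 = i by omega] at h2
      exact h2.2 h3

end Backward

/-! ### The composition of a flag of the free cone -/

section Composition

variable {α : Type u} {m k : ℕ} {M : Matroid α}

open ConeElt

theorem ncard_coneSet {S : Set α} (hS : S.Finite) :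
    (coneSet m S).ncard = (m + 1) * S.ncard + 1 := by
  have hfin : ((fun p : α × Fin m => (copy p.1 p.2 : ConeElt α m)) '' (S ×ˢ Set.univ)).Finite :=
    (hS.prod Set.finite_univ).image _
  have hinj : Function.Injective fun p : α × Fin m => (copy p.1 p.2 : ConeElt α m) := by
    rintro ⟨e, j⟩ ⟨e', j'⟩ h
    rw [copy.injEq] at h
    exact Prod.ext h.1 h.2
  have htop : coneSet m S \ Set.range base =
      insert tip ((fun p : α × Fin m => (copy p.1 p.2 : ConeElt α m)) '' (S ×ˢ Set.univ)) := by
    ext z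
    rcases z with e | ⟨e, j⟩ | _ <;> simp
  rw [ncard_eq_add (coneSet_finite m hS), preimage_coneSet, htop,
    Set.ncard_insert_of_notMem (by simp) hfin, Set.ncard_image_of_injective _ hinj,
    Set.ncard_prod, Set.ncard_univ, Nat.card_fin]
  ring

variable {X : Fin (k + 1) → Set α} {h : ℕ} {C : Finset ℕ} {s : Fin C.card → α × Fin m}

theorem entry_flagComposition_succ (X : Fin (k + 1) → Set α) {i : ℕ} (hi : i < k) :
    entry (flagComposition X) (i + 1) = (flagAt X (i + 1) \ flagAt X i).ncard := by
  rw [entry, dif_pos (by omega), flagComposition_succ X hi]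

variable [M.Finite]

theorem IsFlag.entry_add_ncard (hX : IsFlag M X) {i : ℕ} (hi : i < k) :
    entry (flagComposition X) (i + 1) + (flagAt X i).ncard = (flagAt X (i + 1)).ncard := by
  rw [entry_flagComposition_succ X hi]
  exact Set.ncard_sdiff_add_ncard_of_subset (hX.flagAt_mono (Nat.le_succ i))
    (M.ground_finite.subset (hX.flagAt_subset_ground _))

theorem IsFlag.flagAt_zero_eq_empty [M.Loopless] (hX : IsFlag M X) : flagAt X 0 = ∅ := by
  rw [hX.flagAt_zero, M.loops_eq_empty]

theorem IsFlag.sum_entry [M.Loopless] (hX : IsFlag M X) {i : ℕ} (hi : i ≤ k) :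
    ∑ j ∈ Finset.Icc 1 i, entry (flagComposition X) j = (flagAt X i).ncard := by
  induction i with
  | zero => simp [hX.flagAt_zero_eq_empty]
  | succ i ih =>
    rw [Finset.sum_Icc_succ_top (by omega), ih (by omega), add_comm, hX.entry_add_ncard hi]

section Low

variable (hX : IsFlag M X) (hh : h ≤ k) (hC : C ⊆ Finset.Icc 1 h)
  (hs : IsCopyChoice X (h - C.card) s)

include hX hC hs

theorem ncard_coneChain {i : ℕ} (hi : i ≤ h) : (coneChain X h C s i).ncard =
    (flagAt X (baseCount C i)).ncard + copyCount C i := by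
  have hfin : (coneChain X h C s i).Finite := (coneSet_finite m M.ground_finite).subset
    ((coneChain_low_subset hX hC hs hi).trans (coneSet_mono m (hX.flagAt_subset_ground _)))
  have h2 := copyCount_mono (C := C) hi
  rw [copyCount_of_subset hC] at h2
  rw [ncard_eq_add hfin, coneChain_of_le hi, preimage_image_union, image_union_sdiff,
    hs.ncard_copies hX h2]

include hh

theorem lowEntry_add_ncard {i : ℕ} (hi : i < h) :
    lowEntry (flagComposition X) C (i + 1) + (coneChain X h C s i).ncard =
      (coneChain X h C s (i + 1)).ncard := by
  rw [ncard_coneChain hX hC hs hi.le, ncard_coneChain hX hC hs hi, lowEntry]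
  have h1 := baseCount_mono (C := C) (show i + 1 ≤ h from hi)
  have h2 := baseCount_of_subset hC
  split_ifs with hiC
  · rw [baseCount_succ_of_mem hiC, copyCount_succ_of_mem hiC]
    omega
  · have h3 : (Finset.Icc 1 (i + 1) \ C).card = baseCount C i + 1 := baseCount_succ_of_notMem hiC
    rw [baseCount_succ_of_notMem hiC] at h1 ⊢
    rw [h3, copyCount_succ_of_notMem hiC, ← add_assoc, hX.entry_add_ncard (by omega)]

theorem sum_lowEntry [M.Loopless] {i : ℕ} (hi : i ≤ h) :
    ∑ j ∈ Finset.Icc 1 i, lowEntry (flagComposition X) C j = (coneChain X h C s i).ncard := by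
  induction i with
  | zero =>
    have h0 := baseCount_add_copyCount C 0
    rw [ncard_coneChain hX hC hs hi, copyCount_zero, show baseCount C 0 = 0 by omega,
      hX.flagAt_zero_eq_empty]
    simp
  | succ i ih =>
    rw [Finset.sum_Icc_succ_top (by omega), ih (by omega), add_comm,
      lowEntry_add_ncard hX hh hC hs hi]

theorem flagComposition_coneFlag [M.Loopless] :
    flagComposition (coneFlag X h C s) = coneComposition m (flagComposition X) h C := by
  have hY := isFlag_coneFlag hX hh hC hs
  funext ⟨i, hi⟩
  have hsub : ∀ j, flagAt (coneFlag X h C s) j ⊆ flagAt (coneFlag X h C s) (j + 1) := fun j =>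
    hY.flagAt_mono (Nat.le_succ j)
  cases i with
  | zero =>
    have h1 := flagComposition_zero (coneFlag X h C s)
    have h0 := baseCount_add_copyCount C 0
    rw [flagAt_coneFlag (Nat.zero_le _), ncard_coneChain hX hC hs (Nat.zero_le h), copyCount_zero,
      show baseCount C 0 = 0 by omega, hX.flagAt_zero_eq_empty] at h1
    simpa [coneComposition] using h1
  | succ i =>
    have hdiff := Set.ncard_sdiff_add_ncard_of_subset (hsub i) (flagAt_finite hY (i + 1))
    rw [← flagComposition_succ _ (show i < k + 1 by omega), flagAt_coneFlag (by omega),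
      flagAt_coneFlag (by omega)] at hdiff
    have hfin : ∀ j, (flagAt X j).Finite := fun j =>
      M.ground_finite.subset (hX.flagAt_subset_ground j)
    simp only [coneComposition, Nat.add_eq_zero_iff, one_ne_zero, and_false, if_false,
      Nat.add_right_cancel_iff, Nat.add_sub_cancel]
    rcases lt_trichotomy i h with hih | rfl | hih
    · rw [if_pos (Nat.succ_le_of_lt hih)]
      have := lowEntry_add_ncard hX hh hC hs hih
      omega
    · rw [if_neg (by omega), if_pos rfl, hX.sum_entry hh, sum_lowEntry hX hh hC hs le_rfl]
      rw [coneChain_of_lt (show i < i + 1 by omega), Nat.add_sub_cancel,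
        ncard_coneSet (hfin i)] at hdiff
      omega
    · rw [if_neg (by omega), if_neg (by omega)]
      rw [coneChain_of_lt (show h < i + 1 by omega), coneChain_of_lt hih, Nat.add_sub_cancel,
        ncard_coneSet (hfin i), ncard_coneSet (hfin (i - 1))] at hdiff
      obtain ⟨i, rfl⟩ : ∃ j, i = j + 1 := ⟨i - 1, by omega⟩
      rw [Nat.add_sub_cancel, ← hX.entry_add_ncard (by omega), mul_add] at hdiff
      omega

end Low

/-! ### The `𝒢`-invariant of the free cone -/

open Classical in
/-- The sequences of `c` copies of elements of consecutive blocks of the flag `X`, from the block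
with index `b + 1` on. -/
def copyChoices (m : ℕ) (M : Matroid α) [M.Finite] (X : Fin (k + 1) → Set α) (b c : ℕ) :
    Finset (Fin c → α × Fin m) :=
  Fintype.piFinset fun j : Fin c =>
    (M.ground_finite.toFinset.filter fun x => x ∈ flagAt X (b + j + 1) \ flagAt X (b + j)) ×ˢ
      Finset.univ

theorem mem_copyChoices (hX : IsFlag M X) {b c : ℕ} {s : Fin c → α × Fin m} :
    s ∈ copyChoices m M X b c ↔ IsCopyChoice X b s := by
  simp only [copyChoices, Fintype.mem_piFinset, Finset.mem_product, Finset.mem_filter,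
    Set.Finite.mem_toFinset, Finset.mem_univ, and_true, IsCopyChoice]
  exact forall_congr' fun j => and_iff_right_of_imp fun h => hX.flagAt_subset_ground _ h.1

theorem card_copyChoices (hX : IsFlag M X) {b c : ℕ} (hbc : b + c ≤ k) :
    (copyChoices m M X b c).card =
      ∏ j ∈ Finset.Icc 1 c, m * entry (flagComposition X) (b + j) := by
  have h1 : ∀ n (f : ℕ → ℕ), ∏ j ∈ Finset.Icc 1 n, f j = ∏ j ∈ Finset.range n, f (j + 1) := by
    intro n f
    induction n with
    | zero => simp
    | succ n ih => rw [Finset.prod_Icc_succ_top (by omega), ih, Finset.prod_range_succ]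
  rw [h1, Finset.prod_range, copyChoices, Fintype.card_piFinset]
  refine Finset.prod_congr rfl fun j _ => ?_
  rw [Finset.card_product, Finset.card_univ, Fintype.card_fin, mul_comm, ← add_assoc,
    entry_flagComposition_succ X (by omega), ← Set.ncard_coe_finset]
  congr 2
  ext x
  simp only [Finset.coe_filter, Set.Finite.mem_toFinset, Set.mem_ofPred_eq]
  exact and_iff_right_of_imp fun h => hX.flagAt_subset_ground _ h.1

theorem eRank_freeCone (hk : M.eRank = k) : (freeCone m M).eRank = (k + 1 : ℕ) := by
  have hr : M.natRk M.E = k := M.eRk_eq_iff_natRk.1 (by rw [M.eRk_ground, hk])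
  rw [← Matroid.eRk_ground, Matroid.eRk_eq_iff_natRk, freeCone_ground,
    natRk_freeCone_coneSet m M subset_rfl, hr]

/-- Each flag of `M` contributes `coneGamma` of its composition to the `𝒢`-invariant of the
free cone. -/
theorem gInvariant_freeCone_eq_sum_flags (K : Type w) [Field K] [M.Loopless] (hk : M.eRank = k) :
    gInvariant K (freeCone m M) = ∑ X ∈ flags M k, coneGamma K m (flagComposition X) := by
  classical
  rw [gInvariant_eq_sum_flags K (freeCone m M) (eRank_freeCone hk),
    Finset.sum_eq_sum_of_existsUnique _
      ((Finset.range (k + 1)).sigma fun h => (Finset.Icc 1 h).powerset)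
      (fun Y p => HasConeType Y p.1 p.2) _
      fun Y hY => existsUnique_hasConeType (mem_flags.1 hY) hk,
    Finset.sum_sigma]
  unfold coneGamma
  rw [Finset.sum_comm]
  refine Finset.sum_congr rfl fun h hh => ?_
  rw [Finset.sum_comm]
  refine Finset.sum_congr rfl fun C hC => ?_
  have hh : h ≤ k := Nat.lt_succ_iff.1 (Finset.mem_range.1 hh)
  have hC := Finset.mem_powerset.1 hC
  have hcard := card_le_of_subset_Icc hC
  have hsum : ∀ X ∈ flags M k,
      (∏ j ∈ Finset.Icc 1 C.card, m * entry (flagComposition X) (h - C.card + j)) •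
        gammaVec K (coneComposition m (flagComposition X) h C) =
      ∑ s ∈ copyChoices m M X (h - C.card) C.card,
        gammaVec K (flagComposition (coneFlag X h C s)) := by
    intro X hX
    rw [mem_flags] at hX
    rw [← card_copyChoices hX (by omega), ← Finset.sum_const]
    refine Finset.sum_congr rfl fun s hs => ?_
    rw [flagComposition_coneFlag hX hh hC ((mem_copyChoices hX).1 hs)]
  rw [Finset.sum_congr rfl hsum, Finset.sum_sigma']
  symm
  refine Finset.sum_bij (fun p _ => coneFlag p.1 h C p.2) ?_ ?_ ?_ fun _ _ => rfl
  · rintro ⟨X, s⟩ hp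
    rw [Finset.mem_sigma, mem_flags] at hp
    have hs := (mem_copyChoices hp.1).1 hp.2
    rw [Finset.mem_filter, mem_flags]
    exact ⟨isFlag_coneFlag hp.1 hh hC hs, hasConeType_coneFlag hp.1 hh hC hs⟩
  · rintro ⟨X, s⟩ hp ⟨X', s'⟩ hp' heq
    rw [Finset.mem_sigma, mem_flags] at hp hp'
    obtain ⟨h1, h2⟩ := coneFlag_injective hp.1 hp'.1 hh hC ((mem_copyChoices hp.1).1 hp.2)
      ((mem_copyChoices hp'.1).1 hp'.2) heq
    simp only at h1 h2
    rw [h1, h2]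
  · intro Y hY
    rw [Finset.mem_filter, mem_flags] at hY
    obtain ⟨X, s, hX, hs, heq⟩ := exists_coneFlag_eq hY.1 hh hC hY.2
    exact ⟨⟨X, s⟩, Finset.mem_sigma.2 ⟨mem_flags.2 hX, (mem_copyChoices hX).2 hs⟩, heq⟩

theorem sum_flags_eq_sum_compositions {A : Type*} [AddCommMonoid A] (hk : M.eRank = k)
    (f : (Fin (k + 1) → ℕ) → A) :
    ∑ X ∈ flags M k, f (flagComposition X) =
      ∑ a ∈ compositions M.E.ncard k, catenary M a • f a := by
  classical
  rw [← Finset.sum_fiberwise_of_maps_to (t := compositions M.E.ncard k) (g := flagComposition)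
    fun X hX => (mem_flags.1 hX).flagComposition_mem hk]
  refine Finset.sum_congr rfl fun a _ => ?_
  rw [catenary_eq_card, ← Finset.sum_const]
  exact Finset.sum_congr rfl fun X hX => by rw [(Finset.mem_filter.1 hX).2]

theorem exists_eRank_eq (M : Matroid α) [M.Finite] : ∃ k : ℕ, M.eRank = k :=
  ⟨M.natRk M.E, by rw [M.natRk_cast, M.eRk_ground]⟩

end Composition

theorem gInvariant_freeCone_eq_map {α : Type u} (K : Type w) [Field K] {m : ℕ} (M : Matroid α)
    [M.Finite] [M.Loopless] {Φ : GSpace K →ₗ[K] GSpace K}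
    (hΦ : ∀ (n k : ℕ), ∀ a ∈ compositions n k, Φ (gammaVec K a) = coneGamma K m a) :
    gInvariant K (freeCone m M) = Φ (gInvariant K M) := by
  obtain ⟨k, hk⟩ := exists_eRank_eq M
  rw [gInvariant_freeCone_eq_sum_flags K hk, gInvariant_eq_sum_flags K M hk, map_sum]
  exact Finset.sum_congr rfl fun X hX =>
    (hΦ _ _ _ ((mem_flags.1 hX).flagComposition_mem hk)).symm

end

theorem theorem3p8 (K : Type w) [Field K] [CharZero K] (m : ℕ) (hm : 1 ≤ m) :
    -- the free cone has the prescribed ground set, cyclic flats and ranks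
    (∀ (α : Type u) (M : Matroid α) [M.Finite] [M.Loopless],
      (freeCone m M).E = coneSet m M.E ∧ (freeCone m M).cyclicFlatData = coneData m M) ∧
    -- the explicit formula in the `γ`-basis
    (∀ (α : Type u) (M : Matroid α) [M.Finite] [M.Loopless] (n k : ℕ),
      M.E.ncard = n → M.eRank = k →
      gInvariant K (freeCone m M) = ∑ a ∈ compositions n k, catenary M a • coneGamma K m a) ∧
    -- the map that determines `𝒢(Q_m(M))` from `𝒢(M)`
    (∃ Φ : GSpace K →ₗ[K] GSpace K,
      (∀ (n k : ℕ), ∀ a ∈ compositions n k, Φ (gammaVec K a) = coneGamma K m a) ∧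
      ∀ (α : Type u) (M : Matroid α) [M.Finite] [M.Loopless],
        gInvariant K (freeCone m M) = Φ (gInvariant K M)) ∧
    -- matroids with the same `𝒢`-invariant have free cones with the same `𝒢`-invariant
    (∀ (α : Type u) (β : Type v) (M : Matroid α) (N : Matroid β)
      [M.Finite] [N.Finite] [M.Loopless] [N.Loopless],
      gInvariant K M = gInvariant K N →
      gInvariant K (freeCone m M) = gInvariant K (freeCone m N)) := by
  obtain ⟨Φ, hΦ⟩ := exists_linearMap_gammaVec K fun _ a => coneGamma K m a
  refine ⟨fun α M _ _ => ⟨rfl, cyclicFlatData_freeCone hm⟩, ?_,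
    ⟨Φ, hΦ, fun α M _ _ => gInvariant_freeCone_eq_map K M hΦ⟩, ?_⟩
  · rintro α M _ _ n k rfl hk
    rw [gInvariant_freeCone_eq_sum_flags K hk, sum_flags_eq_sum_compositions hk]
  · intro α β M N _ _ _ _ hMN
    rw [gInvariant_freeCone_eq_map K M hΦ, gInvariant_freeCone_eq_map K N hΦ, hMN]
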